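/- Let $n$ be a positive integer and $\varepsilon,\rho\in(0,1/2)$. A randomized algorithm $\mathcal A$ that takes a fixed number $N$ of i.i.d. samples from an unknown distribution $\mathbf p$ on $[n]=\{1,\dots,n\}$ and uses an internal random seed $r$, independent of the samples, solves *$(n,\varepsilon,\rho)$-replicable uniformity testing* if - for every distribution $\mathbf p$ on $[n]$, $\Pr_{r,T,T'}\big(\mathcal A(T;r)=\mathcal A(T';r)\big)\ge 1-\rho$, where $T,T'\sim\mathbf p^{\otimes N}$ and $r$ are independent; - if $\mathbf p=U_n$ is uniform, $\mathcal A$ accepts with probability at least $1-\rho$; - if $\mathrm{TV}(\mathbf p,U_n)=\frac12\sum_{x}|\mathbf p_x-\frac1n|\ge\varepsilon$, $\mathcal A$ rejects with probability at least $1-\rho$. For samples $T\in[n]^m$ in which element $i$ occurs $X_i$ times put $S(T)=\frac12\sum_{i=1}^n\left|\frac{X_i}{m}-\frac1n\right|$, let $\mu_m(U_n)$ be the expectation of $S(T)$ for $T\sim U_n^{\otimes m}$, and let $$f(m,n,\varepsilon)=\begin{cases}\varepsilon^2m^2/n^2,& m\le n,\\ \varepsilon^2\sqrt{m/n},& n<m\le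 n/\varepsilon^2,\\ \varepsilon,& m>n/\varepsilon^2.\end{cases}$$ Consider the following tester, with parameters $C,c_0,c_1>0$ and $0\le a<b\le 1$. Let $$m=\left\lceil c_1\left(\frac{\sqrt n}{\rho\varepsilon^2}\sqrt{\log\frac n\rho}+\frac1{\rho^2\varepsilon^2}\right)\right\rceil,\qquad m_0=\left\lceil c_0\log\frac1\rho\right\rceil .$$ Draw $m_0$ independent batches of $m$ samples each, compute the statistic $S_j$ of the $j$-th batch for $1\le j\le m_0$, let $S_{\mathrm{median}}$ be the median of $S_1,\dots,S_{m_0}$, draw $r$ uniformly from $[a,b]$, and accept if and only if $S_{\mathrm{median}}<\mu_m(U_n)+r\,C\,f(m,n,\varepsilon)$. **Theorem.** For all fixed $0\le a<b\le1$ there are constants $C,c_0,c_1>0$, $K$ and $k\in\mathbb N$, depending only on $a$ and $b$, such that for every positive integer $n$ and all $\varepsilon,\rho\in(0,1/2)$ the tester above solves $(n,\varepsilon,\rho)$-replicable uniformity testing, and its number of samples satisfies $$m_0\,m\le K\left(\log\frac n\rho\right)^k\left(\frac{\sqrt n}{\varepsilon^2\rho}+\frac1{\rho^2\varepsilon^2}\right),$$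 that is, it takes $\tilde O\left(\frac{\sqrt n}{\varepsilon^2\rho}+\frac1{\rho^2\varepsilon^2}\right)$ samples, where $\tilde O$ hides polylogarithmic factors in $n$ and $1/\rho$. -/

import Mathlib

open MeasureTheory

noncomputable section

namespace ReplicableUniformity

/-- The uniform distribution `U_n` on the `n`-point domain. -/
def unif (n : ℕ) [NeZero n] : PMF (Fin n) :=
  PMF.uniformOfFintype (Fin n)

/-- Total variation distance, `(1/2) ∑ₓ |pₓ - qₓ|`. -/
def tvDist {n : ℕ} (p q : PMF (Fin n)) : ℝ :=
  (1 / 2) * ∑ x, |(p x).toReal - (q x).toReal|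

/-- The law of `N` i.i.d. samples from `p`. -/
def samples {n : ℕ} (p : PMF (Fin n)) (N : ℕ) : Measure (Fin N → Fin n) :=
  Measure.pi fun _ => p.toMeasure

instance {n : ℕ} (p : PMF (Fin n)) (N : ℕ) : IsProbabilityMeasure (samples p N) := by
  unfold samples; infer_instance

/-- A randomized algorithm which takes a fixed number of samples from the domain `Fin n` and
an internal random seed (drawn from a law of its own, independently of the samples), and
accepts (`true`) or rejects (`false`). -/
structure RandAlg (n : ℕ) where
  /-- the number of samples taken -/
  numSamples : ℕ
  /-- the space of random seeds -/
  Seed : Type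
  /-- its measurable structure -/
  [mSeed : MeasurableSpace Seed]
  /-- the law of the seed -/
  seedLaw : Measure Seed
  /-- which is a probability measure -/
  [isProb : IsProbabilityMeasure seedLaw]
  /-- the decision on given samples with a given seed -/
  run : (Fin numSamples → Fin n) → Seed → Bool
  /-- for given samples the decision is a random variable -/
  measurable_run : ∀ T, Measurable (run T)

attribute [instance] RandAlg.mSeed RandAlg.isProb

namespace RandAlg

variable {n : ℕ}

/-- The probability, over seed and samples from `p`, that the output is `b`. -/
def outputProb (A : RandAlg n) (p : PMF (Fin n)) (b : Bool) : ℝ :=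
  (A.seedLaw.prod (samples p A.numSamples)).real {ω | A.run ω.2 ω.1 = b}

/-- The probability that two runs, with the same seed and independent samples from `p`,
have the same output. -/
def agreeProb (A : RandAlg n) (p : PMF (Fin n)) : ℝ :=
  (A.seedLaw.prod ((samples p A.numSamples).prod (samples p A.numSamples))).real
    {ω | A.run ω.2.1 ω.1 = A.run ω.2.2 ω.1}

/-- `ρ`-replicability. -/
def Replicable (A : RandAlg n) (ρ : ℝ) : Prop :=
  ∀ p : PMF (Fin n), 1 - ρ ≤ A.agreeProb p

/-- `A` solves `(n, ε, ρ)`-replicable uniformity testing. -/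
structure Solves [NeZero n] (A : RandAlg n) (ε ρ : ℝ) : Prop where
  replicable : A.Replicable ρ
  accept_unif : 1 - ρ ≤ A.outputProb (unif n) true
  reject_far : ∀ p : PMF (Fin n), ε ≤ tvDist p (unif n) → 1 - ρ ≤ A.outputProb p false

end RandAlg

/-- The number `X_i` of occurrences of `i` among the samples `T`. -/
def occ {n m : ℕ} (T : Fin m → Fin n) (i : Fin n) : ℕ :=
  (Finset.univ.filter fun t => T t = i).card

/-- The total variation statistic `S = (1/2) ∑ᵢ |X_i / m - 1 / n|`. -/
def tvStat {n m : ℕ} (T : Fin m → Fin n) : ℝ :=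
  (1 / 2) * ∑ i, |(occ T i : ℝ) / m - 1 / n|

/-- The expectation `μ(U_n)` of the statistic of `m` uniform samples. -/
def meanUnif (n : ℕ) [NeZero n] (m : ℕ) : ℝ :=
  ∫ T, tvStat T ∂(samples (unif n) m)

/-- The expectation gap, up to a constant factor. -/
def gap (n m : ℕ) (ε : ℝ) : ℝ :=
  if m ≤ n then ε ^ 2 * m ^ 2 / n ^ 2
  else if (m : ℝ) ≤ n / ε ^ 2 then ε ^ 2 * √((m : ℝ) / n)
  else ε

/-- The median of `k` real numbers: the mean of the two middle ones in sorted order, which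
coincide when `k` is odd (and `0` when `k = 0`). -/
def median {k : ℕ} (s : Fin k → ℝ) : ℝ :=
  if h : 0 < k then
    (s (Tuple.sort s ⟨(k - 1) / 2, by omega⟩) + s (Tuple.sort s ⟨k / 2, by omega⟩)) / 2
  else 0

/-- The tester: take `m₀` independent batches of `m` samples, compute the total variation
statistic of every batch, and accept if and only if the median of these statistics is below
the random threshold `μ(U_n) + r * C * gap n m ε`, with `r` uniform in `[a, b]`. -/
def medianTester (n : ℕ) [NeZero n] (ε C a b : ℝ) (hab : a < b) (m₀ m : ℕ) : RandAlg n where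
  numSamples := m₀ * m
  Seed := ℝ
  seedLaw := ProbabilityTheory.cond volume (Set.Icc a b)
  isProb := ProbabilityTheory.cond_isProbabilityMeasure_of_finite
    (by simp [Real.volume_Icc, hab]) (by simp [Real.volume_Icc])
  run T r := decide
    (median (fun j : Fin m₀ => tvStat fun i : Fin m => T (finProdFinEquiv (j, i)))
      < meanUnif n m + r * (C * gap n m ε))
  measurable_run T := by
    refine measurable_to_bool ?_
    simp only [Set.preimage, Set.mem_singleton_iff, decide_eq_true_eq]
    exact measurableSet_lt (by fun_prop) (by fun_prop)

/-- Batch size `Θ(√n √(log (n/ρ)) / (ρ ε²) + 1 / (ρ² ε²))`. -/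
def batchSize (c : ℝ) (n : ℕ) (ε ρ : ℝ) : ℕ :=
  ⌈c * (√n / (ρ * ε ^ 2) * √(Real.log (n / ρ)) + 1 / (ρ ^ 2 * ε ^ 2))⌉₊

/-- Number of batches `Θ(log (1/ρ))`. -/
def numBatches (c : ℝ) (ρ : ℝ) : ℕ :=
  ⌈c * Real.log (1 / ρ)⌉₊

/-- The replicable uniformity tester: `medianTester` with the above choice of parameters. -/
def rUniformityTester (C c₀ c₁ a b : ℝ) (hab : a < b) (n : ℕ) [NeZero n] (ε ρ : ℝ) :
    RandAlg n :=
  medianTester n ε C a b hab (numBatches c₀ ρ) (batchSize c₁ n ε ρ)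

end ReplicableUniformity

end

open MeasureTheory

noncomputable section

namespace ReplicableUniformity

/-! Everything reduces to the mean and variance of the statistic under finite product weights.

Mean. Deviations from `m / n` sum to zero, so `tvStat` is `1 / m` times the sum over `i` of the
positive part of `m / n - X_i`. Its mean is thus `(1 / m) ∑ g (p_i)` with `g` a Bernstein
polynomial, convex because the positive part is. The kink at `m / n` makes `g` strongly convex just
left of `1 / n`, by a local limit lower bound for binomial probabilities. Hence an `ε`-far
distribution has mean at least `gapConst * gap` above the uniform one (`expectation_gap`).

Variance. By Efron–Stein it is at most `1 / m`. This is too weak for `m ≤ n`, where the statistic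
counts missing elements and its variance is controlled by the expected excess of the mean over the
uniform one (`wVar_tvStat_le_of_le`).

Replicability. `exists_window` gives a half-width `W` of at least 64 standard deviations, and taking
the median over the batches makes leaving the window exponentially unlikely. Either `W` is a small
`ρ`-fraction of the threshold range, so that a random threshold rarely hits the window, or the whole
window lies above every threshold and every run rejects. Both correctness claims use the same
windows. -/

/-- The expectation of `F` with respect to the weights `w` on a finite type. -/
def wExp {β : Type*} [Fintype β] (w F : β → ℝ) : ℝ :=
  ∑ x, w x * F x

/-- The variance of `F` with respect to the weights `w`. -/
def wVar {β : Type*} [Fintype β] (w F : β → ℝ) : ℝ :=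
  wExp w (fun x => F x ^ 2) - wExp w F ^ 2

/-- Product weights on tuples. -/
def prodW {α : Type*} {N : ℕ} (w : α → ℝ) (T : Fin N → α) : ℝ :=
  ∏ t, w (T t)

/-! ### Weighted expectations on finite types. -/

section Weights

variable {β : Type*} [Fintype β] {w : β → ℝ}

lemma wExp_add (F G : β → ℝ) : wExp w (fun x => F x + G x) = wExp w F + wExp w G := by
  simp [wExp, mul_add, Finset.sum_add_distrib]

lemma wExp_sub (F G : β → ℝ) : wExp w (fun x => F x - G x) = wExp w F - wExp w G := by
  simp [wExp, mul_sub, Finset.sum_sub_distrib]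

lemma wExp_const_mul (c : ℝ) (F : β → ℝ) : wExp w (fun x => c * F x) = c * wExp w F := by
  simp only [wExp, Finset.mul_sum]
  exact Finset.sum_congr rfl fun _ _ => by ring

lemma wExp_const (hw : ∑ x, w x = 1) (c : ℝ) : wExp w (fun _ => c) = c := by
  simp [wExp, ← Finset.sum_mul, hw]

lemma wExp_sum {ι : Type*} (s : Finset ι) (F : ι → β → ℝ) :
    wExp w (fun x => ∑ i ∈ s, F i x) = ∑ i ∈ s, wExp w (F i) := by
  simp only [wExp, Finset.mul_sum]
  exact Finset.sum_comm

lemma wExp_mono (hw : ∀ x, 0 ≤ w x) {F G : β → ℝ} (h : ∀ x, F x ≤ G x) :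
    wExp w F ≤ wExp w G :=
  Finset.sum_le_sum fun x _ => mul_le_mul_of_nonneg_left (h x) (hw x)

lemma wExp_nonneg (hw : ∀ x, 0 ≤ w x) {F : β → ℝ} (h : ∀ x, 0 ≤ F x) : 0 ≤ wExp w F :=
  Finset.sum_nonneg fun x _ => mul_nonneg (hw x) (h x)

/-- The variance is at most the second moment about any point. -/
lemma wExp_sq_sub_sq_le (hw1 : ∑ x, w x = 1) (F : β → ℝ) (c : ℝ) :
    wVar w F ≤ wExp w (fun x => (F x - c) ^ 2) := by
  unfold wVar
  have : wExp w (fun x => (F x - c) ^ 2)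
      = wExp w (fun x => F x ^ 2) - 2 * c * wExp w F + c ^ 2 := by
    have h : (fun x => (F x - c) ^ 2) = fun x => (F x ^ 2 - 2 * c * F x) + c ^ 2 := by
      funext x; ring
    rw [h, wExp_add, wExp_sub, wExp_const_mul, wExp_const hw1]
  rw [this]
  nlinarith [sq_nonneg (wExp w F - c)]

lemma sq_wExp_le (hw : ∀ x, 0 ≤ w x) (hw1 : ∑ x, w x = 1) (F : β → ℝ) :
    wExp w F ^ 2 ≤ wExp w (fun x => F x ^ 2) := by
  have h0 : 0 ≤ wExp w (fun x => (F x - wExp w F) ^ 2) :=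
    wExp_nonneg hw fun x => sq_nonneg _
  have h : (fun x => (F x - wExp w F) ^ 2)
      = fun x => (F x ^ 2 - 2 * wExp w F * F x) + wExp w F ^ 2 := by
    funext x; ring
  rw [h, wExp_add, wExp_sub, wExp_const_mul, wExp_const hw1] at h0
  nlinarith

lemma wVar_const_mul (c : ℝ) (F : β → ℝ) : wVar w (fun x => c * F x) = c ^ 2 * wVar w F := by
  simp only [wVar, mul_pow, wExp_const_mul]
  ring

lemma abs_wExp_le (hw : ∀ x, 0 ≤ w x) (F : β → ℝ) : |wExp w F| ≤ wExp w (fun x => |F x|) := by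
  unfold wExp
  refine (Finset.abs_sum_le_sum_abs _ _).trans (le_of_eq ?_)
  exact Finset.sum_congr rfl fun x _ => by rw [abs_mul, abs_of_nonneg (hw x)]

end Weights

/-! ### Product weights, Efron–Stein and Chebyshev. -/

section Products

variable {α : Type*} {w : α → ℝ}

lemma prodW_nonneg {N : ℕ} (hw : ∀ x, 0 ≤ w x) (T : Fin N → α) : 0 ≤ prodW w T :=
  Finset.prod_nonneg fun _ _ => hw _

variable [Fintype α]

lemma sum_prodW (hw1 : ∑ x, w x = 1) (N : ℕ) : ∑ T : Fin N → α, prodW w T = 1 := by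
  have h := Finset.prod_univ_sum (fun _ : Fin N => (Finset.univ : Finset α)) (fun _ x => w x)
  simp only [hw1, Finset.prod_const_one, Fintype.piFinset_univ] at h
  exact h.symm

lemma wExp_prodW_prod (N : ℕ) (g : α → ℝ) :
    wExp (prodW w) (fun T : Fin N → α => ∏ j, g (T j)) = wExp w g ^ N := by
  have h := Finset.prod_univ_sum (fun _ : Fin N => (Finset.univ : Finset α))
    (fun _ x => w x * g x)
  simp only [Finset.prod_const, Finset.card_univ, Fintype.card_fin, Fintype.piFinset_univ] at h
  simp only [wExp, prodW, ← Finset.prod_mul_distrib]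
  exact h.symm

lemma wExp_prodW_succ {N : ℕ} (F : (Fin (N + 1) → α) → ℝ) :
    wExp (prodW w) F
      = wExp w fun x => wExp (prodW w) fun T : Fin N → α => F (Fin.cons x T) := by
  simp only [wExp]
  rw [← (Fin.consEquiv fun _ : Fin (N + 1) => α).sum_comp, Fintype.sum_prod_type]
  refine Finset.sum_congr rfl fun x _ => ?_
  rw [Finset.mul_sum]
  refine Finset.sum_congr rfl fun T _ => ?_
  simp [prodW, Fin.consEquiv, Fin.prod_univ_succ, mul_assoc]

/-- The Efron–Stein inequality, with proxies `c t` not depending on coordinate `t`. -/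
theorem efron_stein (hw : ∀ x, 0 ≤ w x) (hw1 : ∑ x, w x = 1) {N : ℕ}
    (F : (Fin N → α) → ℝ) (c : Fin N → (Fin N → α) → ℝ)
    (hc : ∀ t T y, c t (Function.update T t y) = c t T) :
    wVar (prodW w) F ≤ ∑ t, wExp (prodW w) (fun T => (F T - c t T) ^ 2) := by
  unfold wVar
  induction N with
  | zero => simp [wExp, prodW]
  | succ N ih =>
    rw [Fin.sum_univ_succ]
    simp only [wExp_prodW_succ (N := N)]
    set V : α → ℝ := fun x => wExp (prodW w) fun T : Fin N → α => F (Fin.cons x T) with hV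
    have key : ∀ x, wExp (prodW w) (fun T : Fin N → α => F (Fin.cons x T) ^ 2) - V x ^ 2
        ≤ ∑ t : Fin N, wExp (prodW w)
          (fun T : Fin N → α => (F (Fin.cons x T) - c t.succ (Fin.cons x T)) ^ 2) := by
      intro x
      refine ih (fun T => F (Fin.cons x T)) (fun t T => c t.succ (Fin.cons x T)) ?_
      intro t T y
      rw [Fin.cons_update, hc]
    have h2 := wExp_mono hw key
    rw [wExp_sub, wExp_sum] at h2
    -- Total variance is the mean conditional variance, handled by induction, plus the variance of
    -- the conditional mean `V`. For the latter, `c 0` ignores the first coordinate, so its mean at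
    -- any `x₀` serves as a constant centre, and Jensen moves the square inside.
    have h3 : wExp w (fun x => V x ^ 2) - wExp w V ^ 2 ≤ wExp w fun x =>
        wExp (prodW w) fun T : Fin N → α => (F (Fin.cons x T) - c 0 (Fin.cons x T)) ^ 2 := by
      rcases isEmpty_or_nonempty α with hα | ⟨⟨x₀⟩⟩
      · simp [wExp]
      refine (wExp_sq_sub_sq_le hw1 V
        (wExp (prodW w) fun T : Fin N → α => c 0 (Fin.cons x₀ T))).trans ?_
      refine wExp_mono hw fun x => ?_
      have : V x - wExp (prodW w) (fun T : Fin N → α => c 0 (Fin.cons x₀ T))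
          = wExp (prodW w) fun T : Fin N → α => F (Fin.cons x T) - c 0 (Fin.cons x T) := by
        rw [wExp_sub]
        congr 2
        funext T
        rw [← hc 0 (Fin.cons x T) x₀, Fin.update_cons_zero]
      rw [this]
      exact sq_wExp_le (prodW_nonneg hw) (sum_prodW hw1 N) _
    linarith

/-- Chebyshev's inequality. -/
lemma chebyshev {β : Type*} [Fintype β] {w : β → ℝ} (hw : ∀ x, 0 ≤ w x)
    (hw1 : ∑ x, w x = 1) (F : β → ℝ) {v W : ℝ}
    (hv : wVar w F ≤ v) (P : β → Prop) [DecidablePred P]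
    (hP : ∀ x, P x → W < |F x - wExp w F|) (hW : 0 ≤ W) :
    W ^ 2 * wExp w (fun x => if P x then 1 else 0) ≤ v := by
  have h : wExp w (fun x => (F x - wExp w F) ^ 2) = wVar w F := by
    unfold wVar
    have h : (fun x => (F x - wExp w F) ^ 2)
        = fun x => (F x ^ 2 - 2 * wExp w F * F x) + wExp w F ^ 2 := by
      funext x; ring
    rw [h, wExp_add, wExp_sub, wExp_const_mul, wExp_const hw1]
    ring
  rw [← wExp_const_mul]
  refine le_trans (wExp_mono hw fun x => ?_) (h.le.trans hv)
  split_ifs with hx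
  · rw [mul_one, ← sq_abs (F x - _)]
    exact pow_le_pow_left₀ hW (hP x hx).le 2
  · simp only [mul_zero]; positivity

end Products

/-! ### Occurrence counts are binomial. -/

section Occurrences

variable {n : ℕ} {w : Fin n → ℝ}

lemma occ_cons {N : ℕ} (x i : Fin n) (T : Fin N → Fin n) :
    occ (Fin.cons x T : Fin (N + 1) → Fin n) i = (if x = i then 1 else 0) + occ T i := by
  simp only [occ, Finset.card_filter, Fin.sum_univ_succ, Fin.cons_zero, Fin.cons_succ]

lemma sum_occ {N : ℕ} (T : Fin N → Fin n) : ∑ i, occ T i = N := by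
  simp only [occ]
  simpa using (Finset.card_eq_sum_card_fiberwise
    (s := (Finset.univ : Finset (Fin N))) (t := Finset.univ) (f := T) (by simp)).symm

/-- The expectation of a function of a binomial variable. -/
def binExp (m : ℕ) (h : ℕ → ℝ) (x : ℝ) : ℝ :=
  ∑ j ∈ Finset.range (m + 1), h j * ((m.choose j : ℝ) * x ^ j * (1 - x) ^ (m - j))

/-- Conditioning on one trial, by Pascal's rule. This recursion drives the inductions about
`binExp`. -/
lemma binExp_succ (m : ℕ) (h : ℕ → ℝ) (x : ℝ) :
    binExp (m + 1) h x = x * binExp m (fun j => h (j + 1)) x + (1 - x) * binExp m h x := by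
  unfold binExp
  rw [Finset.sum_range_succ' _ (m + 1)]
  have h1 : ∀ j ∈ Finset.range (m + 1),
      h (j + 1) * (((m + 1).choose (j + 1) : ℝ) * x ^ (j + 1) * (1 - x) ^ (m + 1 - (j + 1)))
      = x * (h (j + 1) * ((m.choose j : ℝ) * x ^ j * (1 - x) ^ (m - j)))
        + h (j + 1) * ((m.choose (j + 1) : ℝ) * x ^ (j + 1) * (1 - x) ^ (m - j)) := by
    intro j _
    rw [Nat.choose_succ_succ, Nat.add_sub_add_right]
    push_cast
    ring
  rw [Finset.sum_congr rfl h1, Finset.sum_add_distrib, ← Finset.mul_sum, add_assoc]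
  congr 1
  have h2 : ∀ j ∈ Finset.range m,
      h (j + 1) * ((m.choose (j + 1) : ℝ) * x ^ (j + 1) * (1 - x) ^ (m - j))
      = (1 - x) * (h (j + 1) * ((m.choose (j + 1) : ℝ) * x ^ (j + 1) * (1 - x) ^ (m - (j + 1)))) := by
    intro j hj
    have : m - j = (m - (j + 1)) + 1 := by have := Finset.mem_range.mp hj; omega
    rw [this, pow_succ]; ring
  rw [Finset.sum_range_succ, Finset.sum_congr rfl h2, ← Finset.mul_sum,
    Finset.sum_range_succ' (fun j => h j * ((m.choose j : ℝ) * x ^ j * (1 - x) ^ (m - j))) m]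
  simp [pow_succ]
  ring

lemma wExp_occ (hw1 : ∑ x, w x = 1) (m : ℕ) (i : Fin n) (h : ℕ → ℝ) :
    wExp (prodW w) (fun T : Fin m → Fin n => h (occ T i)) = binExp m h (w i) := by
  induction m generalizing h with
  | zero => simp [wExp, prodW, binExp, occ]
  | succ m ih =>
    rw [wExp_prodW_succ, binExp_succ, ← ih, ← ih]
    have : ∀ x, (wExp (prodW w) fun T : Fin m → Fin n => h (occ (Fin.cons x T : Fin (m + 1) → Fin n) i))
        = (if x = i then 1 else 0) * (wExp (prodW w) (fun T : Fin m → Fin n => h (occ T i + 1))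
          - wExp (prodW w) (fun T : Fin m → Fin n => h (occ T i)))
          + wExp (prodW w) (fun T : Fin m → Fin n => h (occ T i)) := by
      intro x
      simp only [occ_cons]
      split_ifs
      · simp [add_comm]
      · simp
    simp only [this]
    rw [wExp_add, wExp_const hw1]
    simp [wExp]
    ring

end Occurrences

/-! ### Mean and variance of the statistic. -/

section Statistic

variable {n : ℕ} {w : Fin n → ℝ}

/-- The number of occurrences of `i` among the samples other than the `t`-th. -/
def occErase {m : ℕ} (t : Fin m) (T : Fin m → Fin n) (i : Fin n) : ℕ :=
  ((Finset.univ.erase t).filter fun s => T s = i).card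

lemma occErase_update {m : ℕ} (t : Fin m) (T : Fin m → Fin n) (y i : Fin n) :
    occErase t (Function.update T t y) i = occErase t T i := by
  unfold occErase
  congr 1
  refine Finset.filter_congr fun s hs => ?_
  rw [Function.update_of_ne (Finset.ne_of_mem_erase hs)]

lemma occ_eq_occErase {m : ℕ} (t : Fin m) (T : Fin m → Fin n) (i : Fin n) :
    occ T i = (if T t = i then 1 else 0) + occErase t T i := by
  simp only [occ, occErase, Finset.card_filter]
  exact (Finset.add_sum_erase _ _ (Finset.mem_univ t)).symm

/-- The deviations sum to zero, so their absolute values sum to twice the sum of the negative parts.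
-/
lemma tvStat_eq [NeZero n] {m : ℕ} (hm : 0 < m) (T : Fin m → Fin n) :
    tvStat T = (1 / m) * ∑ i, max ((m : ℝ) / n - occ T i) 0 := by
  have hm' : (0 : ℝ) < m := by exact_mod_cast hm
  have hn' : (0 : ℝ) < n := by exact_mod_cast Nat.pos_of_neZero n
  have h0 : ∑ i, ((occ T i : ℝ) - m / n) = 0 := by
    rw [Finset.sum_sub_distrib, ← Nat.cast_sum, sum_occ]
    simp
    field_simp
    ring
  have h1 : ∀ i, |(occ T i : ℝ) / m - 1 / n|
      = (1 / m) * (2 * max ((m : ℝ) / n - occ T i) 0 + (occ T i - m / n)) := by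
    intro i
    have : (occ T i : ℝ) / m - 1 / n = (1 / m) * (occ T i - m / n) := by field_simp
    rw [this, abs_mul, abs_of_pos (by positivity)]
    congr 1
    rcases le_total ((m : ℝ) / n - occ T i) 0 with h | h
    · rw [max_eq_right h, abs_of_nonneg (by linarith)]; ring
    · rw [max_eq_left h, abs_of_nonpos (by linarith)]; ring
  unfold tvStat
  simp only [h1]
  rw [← Finset.mul_sum, Finset.sum_add_distrib, h0, ← Finset.mul_sum]
  ring

lemma wExp_tvStat [NeZero n] (hw1 : ∑ x, w x = 1) {m : ℕ} (hm : 0 < m) :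
    wExp (prodW w) (tvStat (n := n) (m := m))
      = (1 / m) * ∑ i, binExp m (fun j => max ((m : ℝ) / n - j) 0) (w i) := by
  have : (tvStat (n := n) (m := m))
      = fun T => (1 / (m : ℝ)) * ∑ i, max ((m : ℝ) / n - occ T i) 0 :=
    funext (tvStat_eq hm)
  rw [this, wExp_const_mul, wExp_sum]
  congr 1
  exact Finset.sum_congr rfl fun i _ => wExp_occ hw1 m i fun j => max ((m : ℝ) / n - j) 0

/-- The statistic has variance `O(1 / m)` by bounded differences. -/
lemma wVar_tvStat_le (hw : ∀ x, 0 ≤ w x) (hw1 : ∑ x, w x = 1) {m : ℕ} (hm : 0 < m) :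
    wVar (prodW w) (tvStat (n := n) (m := m)) ≤ 1 / m := by
  have hm' : (0 : ℝ) < m := by exact_mod_cast hm
  -- The proxy deletes sample `t` but keeps the divisor `m`, so one term changes by at most `1 / m`.
  refine (efron_stein hw hw1 _
    (fun t T => (1 / 2) * ∑ i, |(occErase t T i : ℝ) / m - 1 / n|) ?_).trans ?_
  · intro t T y
    simp only [occErase_update]
  have key : ∀ (t : Fin m) (T : Fin m → Fin n),
      (tvStat T - (1 / 2) * ∑ i, |(occErase t T i : ℝ) / m - 1 / n|) ^ 2 ≤ (1 / m) ^ 2 := by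
    intro t T
    rw [← sq_abs]
    refine pow_le_pow_left₀ (abs_nonneg _) ?_ 2
    unfold tvStat
    rw [← mul_sub, ← Finset.sum_sub_distrib, abs_mul, abs_of_pos (by norm_num : (0 : ℝ) < 1 / 2)]
    have h1 : ∀ i, |(|(occ T i : ℝ) / m - 1 / n| - |(occErase t T i : ℝ) / m - 1 / n|)|
        ≤ (1 / m) * (if T t = i then 1 else 0) := by
      intro i
      refine (abs_abs_sub_abs_le_abs_sub _ _).trans ?_
      rw [occ_eq_occErase t T i]
      push_cast
      have : ((if T t = i then (1 : ℝ) else 0) + occErase t T i) / m - 1 / n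
          - ((occErase t T i : ℝ) / m - 1 / n) = (1 / m) * (if T t = i then 1 else 0) := by ring
      rw [this, abs_of_nonneg]
      split_ifs <;> positivity
    have h2 := (Finset.abs_sum_le_sum_abs
      (fun i => |(occ T i : ℝ) / m - 1 / n| - |(occErase t T i : ℝ) / m - 1 / n|)
      Finset.univ).trans (Finset.sum_le_sum fun i _ => h1 i)
    rw [← Finset.mul_sum, Finset.sum_ite_eq] at h2
    simp only [Finset.mem_univ, if_true, mul_one] at h2
    have h3 : 0 < 1 / (m : ℝ) := by positivity
    linarith
  refine (Finset.sum_le_sum fun t _ => wExp_mono (prodW_nonneg hw) (key t)).trans ?_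
  simp only [wExp_const (sum_prodW hw1 m), Finset.sum_const, Finset.card_univ, Fintype.card_fin,
    nsmul_eq_mul]
  apply le_of_eq
  field_simp

/-- The number of domain elements that do not occur among the samples. -/
def numMissing {m : ℕ} (T : Fin m → Fin n) : ℝ :=
  ∑ i, if occ T i = 0 then 1 else 0

/-- As `m / n ≤ 1`, only missing elements have a positive part, each equal to `m / n`. -/
lemma tvStat_eq_numMissing [NeZero n] {m : ℕ} (hm : 0 < m) (hmn : m ≤ n) (T : Fin m → Fin n) :
    tvStat T = (1 / n) * numMissing T := by
  have hm' : (0 : ℝ) < m := by exact_mod_cast hm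
  have hn' : (0 : ℝ) < n := by exact_mod_cast Nat.pos_of_neZero n
  rw [tvStat_eq hm, numMissing, Finset.mul_sum, Finset.mul_sum]
  refine Finset.sum_congr rfl fun i _ => ?_
  split_ifs with h
  · rw [h, max_eq_left (by simp; positivity)]
    field_simp
    simp
  · have h1 : (1 : ℝ) ≤ occ T i := by exact_mod_cast Nat.one_le_iff_ne_zero.mpr h
    have h2 : (m : ℝ) / n ≤ 1 := by
      rw [div_le_one hn']; exact_mod_cast hmn
    rw [max_eq_right (by linarith)]
    simp

lemma numMissing_eq {m : ℕ} (t : Fin m) (T : Fin m → Fin n) :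
    numMissing T = (∑ i, if occErase t T i = 0 then (1 : ℝ) else 0)
      - if occErase t T (T t) = 0 then 1 else 0 := by
  have : (if occErase t T (T t) = 0 then (1 : ℝ) else 0)
      = ∑ i, if T t = i then (if occErase t T i = 0 then (1 : ℝ) else 0) else 0 := by
    rw [Finset.sum_ite_eq]; simp
  rw [this, numMissing, ← Finset.sum_sub_distrib]
  refine Finset.sum_congr rfl fun i _ => ?_
  rw [occ_eq_occErase t T i]
  split_ifs <;> simp_all

/-- The left side counts samples whose value recurs. A value seen `X ≥ 2` times contributes `X ≤ 2
(X - 1)`, and the excesses `X - 1` over occurring values sum to `numMissing T - n + m`. -/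
lemma sum_repeated_le {m : ℕ} (T : Fin m → Fin n) :
    ∑ t, (if occErase t T (T t) = 0 then (0 : ℝ) else 1) ≤ 2 * (numMissing T - n + m) := by
  have h1 : ∀ t, (if occErase t T (T t) = 0 then (0 : ℝ) else 1)
      = ∑ i, if T t = i then (if occ T i ≤ 1 then (0 : ℝ) else 1) else 0 := by
    intro t
    rw [Finset.sum_ite_eq]
    simp only [Finset.mem_univ, if_true, occ_eq_occErase t T (T t)]
    congr 1
    simp
  simp only [h1]
  rw [Finset.sum_comm]
  have h2 : ∀ i, ∑ t, (if T t = i then (if occ T i ≤ 1 then (0 : ℝ) else 1) else 0)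
      ≤ 2 * ((if occ T i = 0 then (1 : ℝ) else 0) - 1 + occ T i) := by
    intro i
    rw [← Finset.sum_filter, Finset.sum_const, nsmul_eq_mul]
    change (occ T i : ℝ) * _ ≤ _
    rcases Nat.lt_or_ge (occ T i) 2 with h | h
    · interval_cases h' : occ T i <;> simp
    · have h3 : (2 : ℝ) ≤ occ T i := by exact_mod_cast h
      rw [if_neg (by omega), if_neg (by omega)]
      linarith
  refine (Finset.sum_le_sum fun i _ => h2 i).trans (le_of_eq ?_)
  rw [← Finset.mul_sum, Finset.sum_add_distrib, Finset.sum_sub_distrib, ← Nat.cast_sum, sum_occ]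
  simp [numMissing]

lemma wVar_numMissing_le (hw : ∀ x, 0 ≤ w x) (hw1 : ∑ x, w x = 1) (m : ℕ) :
    wVar (prodW w) (numMissing (n := n) (m := m))
      ≤ 2 * (wExp (prodW w) (numMissing (n := n) (m := m)) - n + m) := by
  -- The proxy predicts that sample `t` carries a value seen nowhere else; the squared error is then
  -- exactly the indicator of a repetition.
  refine (efron_stein hw hw1 _
    (fun t T => (∑ i, if occErase t T i = 0 then (1 : ℝ) else 0) - 1) ?_).trans ?_
  · intro t T y
    simp only [occErase_update]
  have h1 : ∀ (t : Fin m) (T : Fin m → Fin n),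
      (numMissing T - ((∑ i, if occErase t T i = 0 then (1 : ℝ) else 0) - 1)) ^ 2
        = if occErase t T (T t) = 0 then 0 else 1 := by
    intro t T
    rw [numMissing_eq t T]
    split_ifs <;> ring
  simp only [h1]
  rw [← wExp_sum]
  refine (wExp_mono (prodW_nonneg hw) sum_repeated_le).trans (le_of_eq ?_)
  rw [wExp_const_mul, wExp_add, wExp_sub, wExp_const (sum_prodW hw1 m),
    wExp_const (sum_prodW hw1 m)]

lemma wExp_numMissing (hw1 : ∑ x, w x = 1) (m : ℕ) :
    wExp (prodW w) (numMissing (n := n) (m := m)) = ∑ i, (1 - w i) ^ m := by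
  unfold numMissing
  rw [wExp_sum]
  refine Finset.sum_congr rfl fun i _ => ?_
  rw [wExp_occ hw1 m i fun j => if j = 0 then (1 : ℝ) else 0]
  simp [binExp]

/-- Second-order Bonferroni bound; it limits the expected excess `numMissing - n + m` under uniform
samples to `m ^ 2 / (2 * n)`. -/
lemma one_sub_pow_le {x : ℝ} (hx0 : 0 ≤ x) (hx1 : x ≤ 1) (m : ℕ) :
    (1 - x) ^ m ≤ 1 - m * x + (m * (m - 1) / 2) * x ^ 2 := by
  induction m with
  | zero => simp
  | succ m ih =>
    have h := mul_le_mul_of_nonneg_right ih (sub_nonneg.mpr hx1)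
    rw [pow_succ]
    refine h.trans ?_
    push_cast
    have : (0 : ℝ) ≤ (m * (m - 1) / 2) * x ^ 3 := by
      refine mul_nonneg ?_ (by positivity)
      rcases m with _ | m
      · simp
      · push_cast; ring_nf; positivity
    nlinarith

/-- For few samples, the variance of the statistic is controlled by the excess of its mean over
that for the uniform distribution. -/
lemma wVar_tvStat_le_of_le [NeZero n] (hw : ∀ x, 0 ≤ w x) (hw1 : ∑ x, w x = 1) {m : ℕ}
    (hm : 0 < m) (hmn : m ≤ n) :
    (n : ℝ) ^ 2 * wVar (prodW w) (tvStat (n := n) (m := m))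
      ≤ 2 * (n * (wExp (prodW w) (tvStat (n := n) (m := m))
          - wExp (prodW fun _ : Fin n => 1 / (n : ℝ)) (tvStat (n := n) (m := m))))
        + (m : ℝ) ^ 2 / n := by
  have hn' : (0 : ℝ) < n := by exact_mod_cast Nat.pos_of_neZero n
  have hu : ∑ _x : Fin n, 1 / (n : ℝ) = 1 := by simp
  have hS : (tvStat (n := n) (m := m)) = fun T => (1 / (n : ℝ)) * numMissing T :=
    funext (tvStat_eq_numMissing hm hmn)
  rw [hS, wVar_const_mul, wExp_const_mul, wExp_const_mul]
  have h1 := wVar_numMissing_le hw hw1 m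
  have h2 : wExp (prodW fun _ : Fin n => 1 / (n : ℝ)) (numMissing (n := n) (m := m)) - n + m
      ≤ (m : ℝ) ^ 2 / (2 * n) := by
    rw [wExp_numMissing hu]
    simp only [Finset.sum_const, Finset.card_univ, Fintype.card_fin, nsmul_eq_mul]
    have h3 := one_sub_pow_le (x := 1 / (n : ℝ)) (by positivity)
      (by rw [div_le_one hn']; exact_mod_cast Nat.pos_of_neZero n) m
    have h4 := mul_le_mul_of_nonneg_left h3 hn'.le
    have h5 : (n : ℝ) * (1 - m * (1 / n) + (m * (m - 1) / 2) * (1 / n) ^ 2)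
        = n - m + (m : ℝ) ^ 2 / (2 * n) - m / (2 * n) := by field_simp; ring
    have h6 : (0 : ℝ) ≤ m / (2 * n) := by positivity
    linarith
  have h3 : (n : ℝ) ^ 2 * ((1 / n) ^ 2 * wVar (prodW w) (numMissing (n := n) (m := m)))
      = wVar (prodW w) (numMissing (n := n) (m := m)) := by field_simp
  have h4 : ∀ a b : ℝ, (n : ℝ) * (1 / n * a - 1 / n * b) = a - b := by
    intro a b; field_simp
  rw [h3, h4]
  have h5 : (m : ℝ) ^ 2 / n = 2 * ((m : ℝ) ^ 2 / (2 * n)) := by field_simp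
  linarith

end Statistic

/-! ### Derivatives of binomial expectations. -/

section Binomial

/-- Differentiating a Bernstein polynomial takes forward differences of its coefficients. Applied
twice, it expresses the second derivative through second differences of `h`. -/
lemma hasDerivAt_binExp (m : ℕ) (h : ℕ → ℝ) (x : ℝ) :
    HasDerivAt (binExp (m + 1) h)
      (((m + 1 : ℕ) : ℝ) * binExp m (fun j => h (j + 1) - h j) x) x := by
  induction m generalizing h with
  | zero =>
    have : binExp 1 h = fun x => x * h 1 + (1 - x) * h 0 := by
      funext x
      rw [binExp_succ]
      simp [binExp]
    rw [zero_add, this]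
    have h1 := ((hasDerivAt_id x).mul_const (h 1)).add
      (((hasDerivAt_id x).const_sub 1).mul_const (h 0))
    refine h1.congr_deriv ?_
    simp [binExp]
    ring
  | succ m ih =>
    have : binExp (m + 1 + 1) h = fun x =>
        x * binExp (m + 1) (fun j => h (j + 1)) x + (1 - x) * binExp (m + 1) h x := by
      funext x; rw [binExp_succ]
    rw [this]
    have h1 := ((hasDerivAt_id x).mul (ih fun j => h (j + 1))).add
      (((hasDerivAt_id x).const_sub 1).mul (ih h))
    refine h1.congr_deriv ?_
    have h2 : binExp (m + 1) (fun j => h (j + 1) - h j) x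
        = binExp (m + 1) (fun j => h (j + 1)) x - binExp (m + 1) h x := by
      simp only [binExp, sub_mul, Finset.sum_sub_distrib]
    have h3 := binExp_succ m (fun j => h (j + 1) - h j) x
    simp only [id]
    rw [Nat.cast_succ (m + 1)]
    linear_combination h2 * (-1) - ((m + 1 : ℕ) : ℝ) * h3

lemma binExp_nonneg {m : ℕ} {h : ℕ → ℝ} (hh : ∀ j, 0 ≤ h j) {x : ℝ} (hx0 : 0 ≤ x)
    (hx1 : x ≤ 1) : 0 ≤ binExp m h x :=
  Finset.sum_nonneg fun j _ => mul_nonneg (hh j)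
    (mul_nonneg (by positivity) (pow_nonneg (sub_nonneg.mpr hx1) _))

lemma le_binExp {m : ℕ} {h : ℕ → ℝ} (hh : ∀ j, 0 ≤ h j) {x : ℝ} (hx0 : 0 ≤ x)
    (hx1 : x ≤ 1) {j : ℕ} (hj : j ≤ m) :
    h j * ((m.choose j : ℝ) * x ^ j * (1 - x) ^ (m - j)) ≤ binExp m h x :=
  Finset.single_le_sum (f := fun j => h j * ((m.choose j : ℝ) * x ^ j * (1 - x) ^ (m - j)))
    (fun j _ => mul_nonneg (hh j)
      (mul_nonneg (by positivity) (pow_nonneg (sub_nonneg.mpr hx1) _)))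
    (Finset.mem_range.mpr (Nat.lt_succ_of_le hj))

end Binomial

/-! ### Quantitative tangent inequalities. -/

section Convexity

/-- A function with nonnegative second derivative lies above its tangents, and its derivative
is monotone. -/
lemma tangent_le {f f' f'' : ℝ → ℝ} {l u : ℝ} (hf : ∀ x, HasDerivAt f (f' x) x)
    (hf' : ∀ x, HasDerivAt f' (f'' x) x) (h : ∀ x ∈ Set.Icc l u, 0 ≤ f'' x) :
    MonotoneOn f' (Set.Icc l u) ∧
      ∀ x ∈ Set.Icc l u, ∀ y ∈ Set.Icc l u, f y + f' y * (x - y) ≤ f x := by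
  have hmono : MonotoneOn f' (Set.Icc l u) := by
    refine monotoneOn_of_deriv_nonneg (convex_Icc l u)
      (fun x _ => (hf' x).continuousAt.continuousWithinAt)
      (fun x _ => (hf' x).differentiableAt.differentiableWithinAt) fun x hx => ?_
    rw [(hf' x).deriv]
    exact h x (interior_subset hx)
  refine ⟨hmono, fun x hx y hy => ?_⟩
  rcases lt_trichotomy x y with hxy | rfl | hxy
  · obtain ⟨z, hz, he⟩ := exists_hasDerivAt_eq_slope f f' hxy
      (fun x _ => (hf x).continuousAt.continuousWithinAt) fun x _ => hf x
    have h1 := hmono ⟨hx.1.trans hz.1.le, hz.2.le.trans hy.2⟩ hy hz.2.le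
    rw [he, div_le_iff₀ (by linarith)] at h1
    linarith
  · simp
  · obtain ⟨z, hz, he⟩ := exists_hasDerivAt_eq_slope f f' hxy
      (fun x _ => (hf x).continuousAt.continuousWithinAt) fun x _ => hf x
    have h1 := hmono hy ⟨hy.1.trans hz.1.le, hz.2.le.trans hx.2⟩ hz.1.le
    rw [he, le_div_iff₀ (by linarith)] at h1
    linarith

/-- A convex function on `[0, 1]` which is strongly convex just to the left of `y` exceeds its
tangent at `y` by an amount growing with the distance to the left of `y`. -/
lemma tangent_add_le {f f' f'' : ℝ → ℝ} {y v A : ℝ} (hf : ∀ x, HasDerivAt f (f' x) x)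
    (hf' : ∀ x, HasDerivAt f' (f'' x) x) (h : ∀ x ∈ Set.Icc (0 : ℝ) 1, 0 ≤ f'' x)
    (hv : 0 ≤ v) (hvy : v ≤ y) (hy : y ≤ 1) (hA : 0 ≤ A)
    (hs : ∀ x ∈ Set.Icc (y - v) y, 2 * A ≤ f'' x) {x : ℝ} (hx : x ∈ Set.Icc (0 : ℝ) 1) :
    f y + f' y * (x - y) + A * (2 * v * max (y - x) 0 - v ^ 2) ≤ f x := by
  have hy' : y ∈ Set.Icc (0 : ℝ) 1 := ⟨hv.trans hvy, hy⟩
  obtain ⟨-, ht⟩ := tangent_le hf hf' h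
  have hAv : 0 ≤ A * v ^ 2 := by positivity
  rcases le_total y x with hxy | hxy
  · have := ht x hx y hy'
    rw [max_eq_right (by linarith)]
    linarith
  rw [max_eq_left (by linarith)]
  -- After subtracting the parabola the function is still convex on the window `[y - v, y]`.
  have hg : ∀ x, HasDerivAt (fun x => f x - A * (x - y) ^ 2) (f' x - 2 * A * (x - y)) x := by
    intro x
    refine ((hf x).sub ((((hasDerivAt_id x).sub_const y).pow 2).const_mul A)).congr_deriv ?_
    simp
    ring
  have hg' : ∀ x, HasDerivAt (fun x => f' x - 2 * A * (x - y)) (f'' x - 2 * A) x := by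
    intro x
    refine ((hf' x).sub (((hasDerivAt_id x).sub_const y).const_mul (2 * A))).congr_deriv ?_
    simp
  obtain ⟨hm, ht'⟩ := tangent_le (l := y - v) (u := y) hg hg'
    fun x hx => sub_nonneg.mpr (hs x hx)
  have hyy : y ∈ Set.Icc (y - v) y := ⟨by linarith, le_rfl⟩
  have hzz : y - v ∈ Set.Icc (y - v) y := ⟨le_rfl, by linarith⟩
  -- Inside the window, `(y - x) ^ 2 ≥ 2 * v * (y - x) - v ^ 2`. To its left, follow the tangent at
  -- `y - v`, whose slope is at most `f' y - 2 * A * v`. A gain linear in `y - x` is what sums to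
  -- total variation distance.
  rcases le_total (y - v) x with hvx | hvx
  · have h1 := ht' x ⟨hvx, hxy⟩ y hyy
    simp only [sub_self] at h1
    nlinarith [mul_nonneg hA (sq_nonneg (y - x - v))]
  · have h1 := ht' (y - v) hzz y hyy
    have h2 := hm hzz hyy (by linarith)
    have h3 := ht x hx (y - v) ⟨by linarith, by linarith⟩
    simp only [sub_self] at h1 h2
    have h4 : (f' y - 2 * A * v) * (x - (y - v)) ≤ f' (y - v) * (x - (y - v)) :=
      mul_le_mul_of_nonpos_right (by linarith) (by linarith)
    nlinarith

end Convexity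

/-! ### Stirling bounds and a local limit estimate. -/

section LocalLimit

lemma factorial_le_stirling {k : ℕ} (hk : 0 < k) :
    (k.factorial : ℝ) ≤ 2 * (√(2 * k) * (k / Real.exp 1) ^ k) := by
  have h1 : Stirling.stirlingSeq k ≤ Stirling.stirlingSeq 1 := by
    have := Stirling.stirlingSeq'_antitone (Nat.zero_le (k - 1))
    simpa [Nat.sub_add_cancel hk] using this
  have h2 : Stirling.stirlingSeq 1 ≤ 2 := by
    rw [Stirling.stirlingSeq_one, div_le_iff₀ (by positivity)]
    have h3 := Real.exp_one_lt_d9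
    have h4 : (1.4 : ℝ) ≤ √2 := Real.le_sqrt_of_sq_le (by norm_num)
    linarith
  have hk' : (0 : ℝ) < k := by exact_mod_cast hk
  have h3 := h1.trans h2
  rwa [Stirling.stirlingSeq, div_le_iff₀ (by positivity)] at h3

lemma stirling_le_factorial {k : ℕ} (hk : 0 < k) :
    √(2 * k) * (k / Real.exp 1) ^ k ≤ (k.factorial : ℝ) := by
  have hk' : (0 : ℝ) < k := by exact_mod_cast hk
  have h1 : (1 : ℝ) ≤ Stirling.stirlingSeq k := by
    refine le_trans ?_ (Stirling.sqrt_pi_le_stirlingSeq hk.ne')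
    exact Real.one_le_sqrt.mpr (by linarith [Real.pi_gt_three])
  rw [Stirling.stirlingSeq, le_div_iff₀ (by positivity)] at h1
  linarith

/-- Stirling for the three factorials: the powers of `e` cancel, and `√(M - k) ≤ √M` leaves only
`√k`. -/
lemma le_choose {M k : ℕ} (hk : 0 < k) (hkM : k < M) :
    (M : ℝ) ^ M / (8 * √k) ≤ (M.choose k : ℝ) * ((k : ℝ) ^ k * ((M - k : ℕ) : ℝ) ^ (M - k)) := by
  have hM : 0 < M := hk.trans hkM
  have hl : 0 < M - k := by omega
  have hM' : (0 : ℝ) < M := by exact_mod_cast hM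
  have hk' : (0 : ℝ) < k := by exact_mod_cast hk
  have hl' : (0 : ℝ) < ((M - k : ℕ) : ℝ) := by exact_mod_cast hl
  have hlM : ((M - k : ℕ) : ℝ) ≤ M := by exact_mod_cast Nat.sub_le M k
  have h1 := stirling_le_factorial hM
  have h2 := mul_le_mul (factorial_le_stirling hk) (factorial_le_stirling hl) (by positivity)
    (by positivity)
  have h3 : (M.choose k : ℝ) * (k.factorial * (M - k).factorial) = M.factorial := by
    exact_mod_cast (by rw [← mul_assoc]; exact Nat.choose_mul_factorial_mul_factorial hkM.le)
  set l : ℕ := M - k with hl_def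
  have hsplit : Real.exp 1 ^ M = Real.exp 1 ^ k * Real.exp 1 ^ l := by
    rw [← pow_add]; congr 1; omega
  have h4 : √(2 * M) * (M / Real.exp 1) ^ M ≤ (M.choose k : ℝ) *
      (2 * (√(2 * k) * (k / Real.exp 1) ^ k) * (2 * (√(2 * l) * (l / Real.exp 1) ^ l))) := by
    refine h1.trans (h3.symm.le.trans ?_)
    exact mul_le_mul_of_nonneg_left h2 (by positivity)
  have h5 : √(2 * M) * (M : ℝ) ^ M ≤ (M.choose k : ℝ) * ((k : ℝ) ^ k * (l : ℝ) ^ l)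
      * (4 * √(2 * k) * √(2 * l)) := by
    rw [div_pow, div_pow, div_pow, hsplit] at h4
    have he : 0 < Real.exp 1 ^ k * Real.exp 1 ^ l := by positivity
    have h6 := mul_le_mul_of_nonneg_right h4 he.le
    refine le_trans (le_of_eq ?_) (h6.trans (le_of_eq ?_)) <;> field_simp
    ring
  have h6 : √(2 * l) ≤ √(2 * M) := Real.sqrt_le_sqrt (by linarith)
  have h7 : √(2 * (k : ℝ)) ≤ 2 * √k := by
    rw [Real.sqrt_mul (by norm_num)]
    have : √2 ≤ 2 := Real.sqrt_le_iff.mpr (by norm_num)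
    nlinarith [Real.sqrt_nonneg (k : ℝ)]
  have h8 : √(2 * M) * (M : ℝ) ^ M ≤ √(2 * M) * ((M.choose k : ℝ) * ((k : ℝ) ^ k * (l : ℝ) ^ l)
      * (8 * √k)) := by
    refine h5.trans ?_
    have h9 : (0 : ℝ) ≤ (M.choose k : ℝ) * ((k : ℝ) ^ k * (l : ℝ) ^ l) := by positivity
    have h10 : √(2 * k) * √(2 * l) ≤ 2 * √k * √(2 * M) :=
      mul_le_mul h7 h6 (by positivity) (by positivity)
    have := mul_le_mul_of_nonneg_left h10 h9
    linarith
  have h9 := le_of_mul_le_mul_left h8 (by positivity)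
  rwa [div_le_iff₀ (by positivity)]

lemma exp_le_div_pow {s t : ℝ} (hs : 0 < s) (ht : 0 < t) (k : ℕ) :
    Real.exp (k * (1 - t / s)) ≤ (s / t) ^ k := by
  rw [Real.exp_nat_mul]
  refine pow_le_pow_left₀ (Real.exp_pos _).le ?_ k
  rw [← Real.le_log_iff_exp_le (by positivity)]
  have := Real.one_sub_inv_le_log_of_pos (div_pos hs ht)
  rwa [inv_div] at this

/-- A lower bound for binomial probabilities near the mean. -/
theorem le_binomial_prob {M k : ℕ} (hM : 0 < M) (hkM : k < M) {x : ℝ} (hx0 : 0 < x)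
    (hx1 : x < 1) :
    Real.exp (-((M * x - k) ^ 2 / (M * x * (1 - x)))) / (8 * √(k + 1))
      ≤ (M.choose k : ℝ) * x ^ k * (1 - x) ^ (M - k) := by
  have hM' : (0 : ℝ) < M := by exact_mod_cast hM
  have hx1' : 0 < 1 - x := by linarith
  have hcast : ((M - k : ℕ) : ℝ) = M - k := Nat.cast_sub hkM.le
  have hl : (0 : ℝ) < M - k := by
    have : (k : ℝ) < M := by exact_mod_cast hkM
    linarith
  have hsq : √(k : ℝ) ≤ √(k + 1) := Real.sqrt_le_sqrt (by linarith)
  rcases Nat.eq_zero_or_pos k with rfl | hk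
  · have h1 := exp_le_div_pow hx1' one_pos M
    have h2 : -(((M : ℝ) * x - (0 : ℕ)) ^ 2 / (M * x * (1 - x))) = M * (1 - 1 / (1 - x)) := by
      simp only [Nat.cast_zero]
      field_simp
      ring
    rw [h2]
    simp only [Nat.choose_zero_right, Nat.cast_one, pow_zero, mul_one, one_mul, Nat.sub_zero,
      Nat.cast_zero, zero_add, Real.sqrt_one]
    rw [div_one] at h1
    have := Real.exp_pos ((M : ℝ) * (1 - 1 / (1 - x)))
    linarith
  have hk' : (0 : ℝ) < k := by exact_mod_cast hk
  have h1 := exp_le_div_pow hx0 (div_pos hk' hM') k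
  have h2 := exp_le_div_pow hx1' (div_pos hl hM') (M - k)
  have h3 := mul_le_mul h1 h2 (Real.exp_pos _).le (by positivity)
  rw [← Real.exp_add] at h3
  -- The bound `log y ≥ 1 - 1 / y` replaces relative entropy by the chi-square distance, which has
  -- this closed form.
  have h4 : (k : ℝ) * (1 - k / M / x) + ((M - k : ℕ) : ℝ) * (1 - (M - k) / M / (1 - x))
      = -((M * x - k) ^ 2 / (M * x * (1 - x))) := by
    rw [hcast]; field_simp; ring
  rw [h4] at h3
  have h5 := le_choose hk hkM
  rw [hcast] at h5
  have hsplit : (M : ℝ) ^ M = (M : ℝ) ^ k * (M : ℝ) ^ (M - k) := by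
    rw [← pow_add]; congr 1; omega
  have h6 : (x / (k / M)) ^ k * ((1 - x) / ((M - k) / M)) ^ (M - k)
      * ((M.choose k : ℝ) * ((k : ℝ) ^ k * ((M : ℝ) - k) ^ (M - k)))
      = (M.choose k : ℝ) * x ^ k * (1 - x) ^ (M - k) * (M : ℝ) ^ M := by
    rw [hsplit]
    simp only [div_pow]
    field_simp
  have h7 := mul_le_mul h3 h5 (by positivity) (by positivity)
  rw [h6] at h7
  have h8 : Real.exp (-((M * x - k) ^ 2 / (M * x * (1 - x)))) / (8 * √k) * (M : ℝ) ^ M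
      ≤ (M.choose k : ℝ) * x ^ k * (1 - x) ^ (M - k) * (M : ℝ) ^ M := by
    refine le_trans (le_of_eq ?_) h7
    ring
  refine le_trans ?_ (le_of_mul_le_mul_right h8 (by positivity))
  have : 0 < √(k : ℝ) := by positivity
  gcongr

end LocalLimit

/-! ### The expectation gap in the three regimes. -/

section Gap

variable {n : ℕ} {w : Fin n → ℝ}

lemma sum_max_eq [NeZero n] (hw1 : ∑ x, w x = 1) :
    ∑ i, max (1 / (n : ℝ) - w i) 0 = (1 / 2) * ∑ i, |w i - 1 / n| := by
  have hn' : (n : ℝ) ≠ 0 := by exact_mod_cast NeZero.ne n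
  have h0 : ∑ i, (w i - 1 / (n : ℝ)) = 0 := by
    rw [Finset.sum_sub_distrib, hw1]
    simp [hn']
  have h1 : ∀ i, |w i - 1 / n| = 2 * max (1 / (n : ℝ) - w i) 0 + (w i - 1 / n) := by
    intro i
    rcases le_total (1 / (n : ℝ) - w i) 0 with h | h
    · rw [max_eq_right h, abs_of_nonneg (by linarith)]; ring
    · rw [max_eq_left h, abs_of_nonpos (by linarith)]; ring
  simp only [h1]
  rw [Finset.sum_add_distrib, h0, ← Finset.mul_sum]
  ring

lemma weight_le_one (hw : ∀ x, 0 ≤ w x) (hw1 : ∑ x, w x = 1) (i : Fin n) : w i ≤ 1 := by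
  rw [← hw1]
  exact Finset.single_le_sum (fun j _ => hw j) (Finset.mem_univ i)

/-- A convex symmetric functional of the probabilities grows away from the uniform distribution. -/
lemma add_le_sum_binExp [NeZero n] (hw : ∀ x, 0 ≤ w x) (hw1 : ∑ x, w x = 1) {ε : ℝ}
    (hε : 0 < ε) (hε1 : ε < 1 / 2) (hfar : ε ≤ (1 / 2) * ∑ i, |w i - 1 / n|)
    {M : ℕ} {h : ℕ → ℝ} (hconv : ∀ j, 0 ≤ h (j + 1 + 1) - h (j + 1) - (h (j + 1) - h j))
    {A : ℝ} (hA : 0 ≤ A)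
    (hs : ∀ x ∈ Set.Icc (1 / (n : ℝ) - ε / (4 * n)) (1 / n), 2 * A ≤ ((M + 2 : ℕ) : ℝ) *
      (((M + 1 : ℕ) : ℝ) * binExp M (fun j => h (j + 1 + 1) - h (j + 1) - (h (j + 1) - h j)) x)) :
    (n : ℝ) * binExp (M + 2) h (1 / n) + A * (ε ^ 2 / (4 * n))
      ≤ ∑ i, binExp (M + 2) h (w i) := by
  have hn : (1 : ℝ) ≤ n := by exact_mod_cast Nat.pos_of_neZero n
  have hn' : (0 : ℝ) < n := by linarith
  -- Summing the tangent bounds gains `2 * v * ε` and loses `n * v ^ 2`, so `v` should be of order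
  -- `ε / n`; the linear terms cancel since the weights sum to one.
  set v : ℝ := ε / (4 * n) with hv
  have hv0 : 0 ≤ v := by positivity
  have hvy : v ≤ 1 / n := by
    rw [hv, div_le_div_iff₀ (by positivity) hn']
    nlinarith
  set f' : ℝ → ℝ := fun x => ((M + 2 : ℕ) : ℝ) * binExp (M + 1) (fun j => h (j + 1) - h j) x
    with hf'
  have key := fun i => tangent_add_le (f := binExp (M + 2) h) (f' := f')
    (fun x => hasDerivAt_binExp (M + 1) h x)
    (fun x => (hasDerivAt_binExp M (fun j => h (j + 1) - h j) x).const_mul _)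
    (fun x hx => mul_nonneg (Nat.cast_nonneg _)
      (mul_nonneg (Nat.cast_nonneg _) (binExp_nonneg hconv hx.1 hx.2)))
    hv0 hvy ((div_le_one hn').mpr hn) hA hs ⟨hw i, weight_le_one hw hw1 i⟩
  refine le_trans ?_ (Finset.sum_le_sum fun i _ => key i)
  have h0 : ∑ i, (w i - 1 / (n : ℝ)) = 0 := by
    rw [Finset.sum_sub_distrib, hw1]
    simp [hn'.ne']
  rw [Finset.sum_add_distrib, Finset.sum_add_distrib, ← Finset.mul_sum, ← Finset.mul_sum, h0,
    Finset.sum_sub_distrib, ← Finset.mul_sum, sum_max_eq hw1]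
  simp only [Finset.sum_const, Finset.card_univ, Fintype.card_fin, nsmul_eq_mul, mul_zero,
    add_zero]
  gcongr
  have h1 : 2 * v * ε ≤ 2 * v * ((1 / 2) * ∑ i, |w i - 1 / n|) := by gcongr
  have h2 : 2 * v * ε - n * v ^ 2 = 7 * (ε ^ 2 / (16 * n)) := by
    rw [hv]; field_simp; ring
  have h3 : ε ^ 2 / (4 * n) = 4 * (ε ^ 2 / (16 * n)) := by field_simp; ring
  have h4 : 0 ≤ ε ^ 2 / (16 * n) := by positivity
  linarith

/-- The constant in the lower bound for the expectation gap. -/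
def gapConst : ℝ := Real.exp (-20) / 512

lemma gapConst_pos : 0 < gapConst := by unfold gapConst; positivity

lemma gapConst_le : gapConst ≤ 1 / 2 := by
  have : Real.exp (-20) ≤ 1 := Real.exp_le_one_iff.mpr (by norm_num)
  unfold gapConst
  linarith

lemma max_sub_nat_convex (l : ℝ) (j : ℕ) :
    0 ≤ max (l - (j + 1 + 1 : ℕ)) 0 - max (l - (j + 1 : ℕ)) 0
      - (max (l - (j + 1 : ℕ)) 0 - max (l - (j : ℕ)) 0) := by
  push_cast
  rcases max_cases (l - (j + 1 + 1 : ℝ)) 0 with h1 | h1 <;>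
  rcases max_cases (l - (j + 1 : ℝ)) 0 with h2 | h2 <;>
  rcases max_cases (l - (j : ℝ)) 0 with h3 | h3 <;> linarith

/-- The kink of `t ↦ (l - t)⁺` is seen by one of the two second differences around `l`. -/
lemma exists_max_sub_nat_ge {l : ℝ} (hl : 1 ≤ l) : ∃ k : ℕ, (k : ℝ) ≤ l ∧ l < k + 2 ∧
    1 / 2 ≤ max (l - (k + 1 + 1 : ℕ)) 0 - max (l - (k + 1 : ℕ)) 0
      - (max (l - (k + 1 : ℕ)) 0 - max (l - (k : ℕ)) 0) := by
  have h1 := Nat.floor_le (by linarith : 0 ≤ l)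
  have h2 := Nat.lt_floor_add_one l
  have h3 : 1 ≤ ⌊l⌋₊ := Nat.le_floor (by simpa using hl)
  obtain ⟨K, hK⟩ : ∃ K, ⌊l⌋₊ = K + 1 := ⟨⌊l⌋₊ - 1, by omega⟩
  rw [hK] at h1 h2
  push_cast at h1 h2
  -- The second differences at `K + 1` and `K` are the fractional part of `l` and its complement, so
  -- one is at least `1 / 2`.
  rcases le_total (1 / 2) (l - (K + 1)) with h | h
  · refine ⟨K + 1, by push_cast; linarith, by push_cast; linarith, ?_⟩
    push_cast
    rw [max_eq_right (by linarith), max_eq_right (by linarith), max_eq_left (by linarith)]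
    linarith
  · refine ⟨K, by linarith, by linarith, ?_⟩
    push_cast
    rw [max_eq_right (by linarith), max_eq_left (by linarith), max_eq_left (by linarith)]
    linarith

/-- The squared deviation is at most `4 * l` and `M * x * (1 - x) ≥ l / 5`, whence the exponent
`20`. -/
lemma le_binomial_prob_of_near {M k : ℕ} {l x : ℝ} (hl : 1 ≤ l) (hM : 0 < M) (hkM : k < M)
    (hx0 : 0 < x) (hx1 : x ≤ 1 / 2) (hk : k + 1 ≤ 2 * l) (hlb : -(2 * √l) ≤ M * x - k)
    (hub : M * x - k ≤ 2 * √l) (hMl : l * (2 / 5) ≤ M * x) :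
    Real.exp (-20) / (16 * √l) ≤ (M.choose k : ℝ) * x ^ k * (1 - x) ^ (M - k) := by
  have hsl2 : √l * √l = l := Real.mul_self_sqrt (by linarith)
  have hsl : 1 ≤ √l := Real.one_le_sqrt.mpr hl
  have hMx0 : 0 < (M : ℝ) * x := by linarith
  refine le_trans ?_ (le_binomial_prob hM hkM hx0 (by linarith))
  have h3 : Real.exp (-20) ≤ Real.exp (-((M * x - k) ^ 2 / (M * x * (1 - x)))) := by
    apply Real.exp_le_exp.mpr
    have h10 : M * x * (1 / 2) ≤ M * x * (1 - x) := mul_le_mul_of_nonneg_left (by linarith) hMx0.le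
    rw [neg_le_neg_iff, div_le_iff₀ (by linarith)]
    have h9 : (M * x - k) ^ 2 ≤ (2 * √l) ^ 2 := sq_le_sq' hlb hub
    have h11 : (2 * √l) ^ 2 = 4 * l := by rw [mul_pow, sq (√l), hsl2]; norm_num
    linarith
  have h4 : √((k : ℝ) + 1) ≤ 2 * √l := by
    refine Real.sqrt_le_iff.mpr ⟨by positivity, ?_⟩
    have h11 : (2 * √l) ^ 2 = 4 * l := by rw [mul_pow, sq (√l), hsl2]; norm_num
    linarith
  refine div_le_div₀ (Real.exp_pos _).le h3 (by positivity) ?_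
  linarith

/-- The free shift `a` lets the induction absorb the extra success. -/
lemma binExp_add_sq (m : ℕ) (a x : ℝ) :
    binExp m (fun j => (j + a) ^ 2) x = (m * x + a) ^ 2 + m * x * (1 - x) := by
  induction m generalizing a with
  | zero => simp [binExp]
  | succ m ih =>
    rw [binExp_succ, ih]
    have : (fun j : ℕ => (((j + 1 : ℕ) : ℝ) + a) ^ 2) = fun j : ℕ => ((j : ℝ) + (1 + a)) ^ 2 := by
      funext j; push_cast; ring
    rw [this, ih]
    push_cast
    ring

lemma binExp_id (m : ℕ) (a x : ℝ) : binExp m (fun j => j + a) x = m * x + a := by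
  induction m generalizing a with
  | zero => simp [binExp]
  | succ m ih =>
    rw [binExp_succ, ih]
    have : (fun j : ℕ => (((j + 1 : ℕ) : ℝ) + a)) = fun j : ℕ => ((j : ℝ) + (1 + a)) := by
      funext j; push_cast; ring
    rw [this, ih]
    push_cast
    ring

/-- Jensen in each coordinate, since `X_i / m` has mean `w i`. -/
lemma tv_le_wExp_tvStat (hw : ∀ x, 0 ≤ w x) (hw1 : ∑ x, w x = 1) {m : ℕ} (hm : 0 < m) :
    (1 / 2) * ∑ i, |w i - 1 / n| ≤ wExp (prodW w) (tvStat (n := n) (m := m)) := by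
  have hm' : (m : ℝ) ≠ 0 := by exact_mod_cast hm.ne'
  unfold tvStat
  rw [wExp_const_mul, wExp_sum]
  gcongr with i
  refine le_trans (le_of_eq ?_) (abs_wExp_le (prodW_nonneg hw) _)
  congr 1
  rw [wExp_sub, wExp_const (sum_prodW hw1 m)]
  have h1 := wExp_occ hw1 m i fun j => (j : ℝ) + 0
  rw [binExp_id] at h1
  have h2 := wExp_const_mul (w := prodW w) (1 / (m : ℝ)) fun T : Fin m → Fin n => (occ T i : ℝ) + 0
  rw [h1] at h2
  have h3 : (fun T : Fin m → Fin n => (1 / (m : ℝ)) * ((occ T i : ℝ) + 0))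
      = fun T => (occ T i : ℝ) / m := by funext T; ring
  rw [h3] at h2
  rw [h2]
  field_simp
  ring

lemma wExp_unif_tvStat_le [NeZero n] {m : ℕ} (hm : 0 < m) :
    wExp (prodW fun _ : Fin n => 1 / (n : ℝ)) (tvStat (n := n) (m := m))
      ≤ (1 / 2) * √((n : ℝ) / m) := by
  have hn' : (0 : ℝ) < n := by exact_mod_cast Nat.pos_of_neZero n
  have hn1 : (1 : ℝ) ≤ n := by exact_mod_cast Nat.pos_of_neZero n
  have hm' : (0 : ℝ) < m := by exact_mod_cast hm
  have hu : ∑ _x : Fin n, 1 / (n : ℝ) = 1 := by simp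
  have hu0 : ∀ _x : Fin n, 0 ≤ 1 / (n : ℝ) := fun _ => by positivity
  unfold tvStat
  rw [wExp_const_mul, wExp_sum]
  gcongr
  have key : ∀ i : Fin n, wExp (prodW fun _ : Fin n => 1 / (n : ℝ))
      (fun T : Fin m → Fin n => |(occ T i : ℝ) / m - 1 / n|) ≤ √(1 / (n * m)) := by
    intro i
    refine Real.le_sqrt_of_sq_le ((sq_wExp_le (prodW_nonneg hu0) (sum_prodW hu m) _).trans ?_)
    have h1 := wExp_occ hu m i fun j => ((j : ℝ) + (-(m / n))) ^ 2
    rw [binExp_add_sq] at h1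
    have h2 := wExp_const_mul (w := prodW fun _ : Fin n => 1 / (n : ℝ)) (1 / (m : ℝ) ^ 2)
      fun T : Fin m → Fin n => ((occ T i : ℝ) + (-(m / n))) ^ 2
    rw [h1] at h2
    have h3 : (fun T : Fin m → Fin n => |(occ T i : ℝ) / m - 1 / n| ^ 2)
        = fun T => 1 / (m : ℝ) ^ 2 * ((occ T i : ℝ) + (-(m / n))) ^ 2 := by
      funext T
      rw [sq_abs]
      field_simp
      ring
    rw [h3, h2]
    have h4 : 1 / (m : ℝ) ^ 2 * ((m * (1 / n) + -(m / n)) ^ 2 + m * (1 / n) * (1 - 1 / (n : ℝ)))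
        = 1 / (n * m) - 1 / (n ^ 2 * m) := by field_simp; ring
    rw [h4]
    have : 0 ≤ 1 / ((n : ℝ) ^ 2 * m) := by positivity
    linarith
  refine (Finset.sum_le_sum fun i _ => key i).trans (le_of_eq ?_)
  simp only [Finset.sum_const, Finset.card_univ, Fintype.card_fin, nsmul_eq_mul]
  have : (n : ℝ) / m = n ^ 2 * (1 / (n * m)) := by field_simp
  rw [this, Real.sqrt_mul (by positivity), Real.sqrt_sq hn'.le]

set_option maxHeartbeats 400000 in
/-- The expectation gap between distributions far from uniform and the uniform distribution. -/
theorem expectation_gap [NeZero n] (hw : ∀ x, 0 ≤ w x) (hw1 : ∑ x, w x = 1) {ε : ℝ}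
    (hε : 0 < ε) (hε1 : ε < 1 / 2) (hfar : ε ≤ (1 / 2) * ∑ i, |w i - 1 / n|) {m : ℕ}
    (hm : 8 ≤ m) :
    wExp (prodW fun _ : Fin n => 1 / (n : ℝ)) (tvStat (n := n) (m := m)) + gapConst * gap n m ε
      ≤ wExp (prodW w) (tvStat (n := n) (m := m)) := by
  have hm0 : 0 < m := by omega
  have hm' : (8 : ℝ) ≤ m := by exact_mod_cast hm
  have hn' : (0 : ℝ) < n := by exact_mod_cast Nat.pos_of_neZero n
  have hu : ∑ _x : Fin n, 1 / (n : ℝ) = 1 := by simp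
  by_cases hreg : (m : ℝ) ≤ n / ε ^ 2
  swap
  -- Beyond `n / ε ^ 2` samples no convexity is needed: the uniform mean is at most `ε / 2`, the far
  -- one at least `ε`.
  · have h1 : ¬ m ≤ n := by
      intro h
      refine hreg (le_trans (by exact_mod_cast h : (m : ℝ) ≤ n) ?_)
      rw [le_div_iff₀ (by positivity)]
      exact mul_le_of_le_one_right hn'.le (by nlinarith)
    rw [gap, if_neg h1, if_neg hreg]
    have h2 := wExp_unif_tvStat_le (n := n) hm0
    have h3 := tv_le_wExp_tvStat hw hw1 hm0
    have h4 : √((n : ℝ) / m) ≤ ε := by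
      rw [not_le, div_lt_iff₀ (by positivity)] at hreg
      refine Real.sqrt_le_iff.mpr ⟨hε.le, ?_⟩
      rw [div_le_iff₀ (by linarith)]
      linarith
    have := mul_le_mul_of_nonneg_right gapConst_le hε.le
    linarith
  have hn2 : (2 : ℝ) ≤ n := by
    by_contra hlt
    have h1 : n = 1 := by
      have h2 : n < 2 := by exact_mod_cast not_le.mp hlt
      have := Nat.pos_of_neZero n
      omega
    subst h1
    have h0 : w 0 = 1 := by simpa using hw1
    simp [h0] at hfar
    linarith
  obtain ⟨M, rfl⟩ : ∃ M, m = M + 2 := ⟨m - 2, by omega⟩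
  have hM6 : 6 ≤ M := by omega
  have hMc : ((M + 2 : ℕ) : ℝ) = M + 2 := by push_cast; ring
  set l : ℝ := ((M + 2 : ℕ) : ℝ) / n with hl
  have hl0 : 0 < l := by positivity
  have hln : l * n = M + 2 := by rw [hl, hMc]; field_simp
  set h : ℕ → ℝ := fun j => max (l - j) 0 with hh
  have hconv : ∀ j, 0 ≤ h (j + 1 + 1) - h (j + 1) - (h (j + 1) - h j) :=
    fun j => max_sub_nat_convex l j
  have hMM : (M + 2 : ℝ) ^ 2 / 2 ≤ (M + 2 : ℝ) * (M + 1) := by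
    have : (0 : ℝ) ≤ M := Nat.cast_nonneg M
    nlinarith
  have hxb : ∀ x ∈ Set.Icc (1 / (n : ℝ) - ε / (4 * n)) (1 / n),
      7 / 8 ≤ n * x ∧ n * x ≤ 1 ∧ 0 < x ∧ x ≤ 1 / 2 ∧ 1 - ε / 4 ≤ n * x := by
    intro x hx
    have h1 : 1 - ε / 4 ≤ n * x := by
      have := mul_le_mul_of_nonneg_left hx.1 hn'.le
      refine le_trans (le_of_eq ?_) this
      field_simp
    have h2 : n * x ≤ 1 := by
      have := mul_le_mul_of_nonneg_left hx.2 hn'.le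
      refine this.trans (le_of_eq ?_)
      field_simp
    have h3 : 0 < x := by
      by_contra h4
      nlinarith
    exact ⟨by linarith, h2, h3, by nlinarith, h1⟩
  suffices hmain : ∃ A, 0 ≤ A ∧
      gapConst * gap n (M + 2) ε ≤ 1 / ((M + 2 : ℕ) : ℝ) * (A * (ε ^ 2 / (4 * n))) ∧
      ∀ x ∈ Set.Icc (1 / (n : ℝ) - ε / (4 * n)) (1 / n),
        2 * A ≤ (M + 2 : ℝ) * (M + 1) *
          binExp M (fun j => h (j + 1 + 1) - h (j + 1) - (h (j + 1) - h j)) x by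
    obtain ⟨A, hA, hg, hs⟩ := hmain
    have key := add_le_sum_binExp (M := M) hw hw1 hε hε1 hfar hconv hA fun x hx => by
      refine (hs x hx).trans (le_of_eq ?_)
      push_cast
      ring
    rw [wExp_tvStat hw1 hm0, wExp_tvStat hu hm0]
    simp only [Finset.sum_const, Finset.card_univ, Fintype.card_fin, nsmul_eq_mul]
    have := mul_le_mul_of_nonneg_left key (by positivity : 0 ≤ 1 / ((M + 2 : ℕ) : ℝ))
    rw [mul_add] at this
    linarith
  by_cases hmn : M + 2 ≤ n
  · have hl1 : l ≤ 1 := by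
      rw [hl, div_le_one hn']; exact_mod_cast hmn
    -- For `l ≤ 1` the term `j = 0` suffices: its second difference is `l` and its probability is
    -- bounded below.
    refine ⟨(M + 2) ^ 2 * l * Real.exp (-20) / 32, by positivity, ?_, ?_⟩
    · rw [gap, if_pos hmn, gapConst, hl, hMc]
      have h0 : (0 : ℝ) ≤ Real.exp (-20) * ε ^ 2 * (M + 2) ^ 2 / n ^ 2 := by positivity
      have h1 : Real.exp (-20) / 512 * (ε ^ 2 * (M + 2 : ℝ) ^ 2 / n ^ 2)
          = (Real.exp (-20) * ε ^ 2 * (M + 2) ^ 2 / n ^ 2) / 512 := by ring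
      have h2 : 1 / (M + 2 : ℝ) * ((M + 2) ^ 2 * ((M + 2) / n) * Real.exp (-20) / 32
          * (ε ^ 2 / (4 * n))) = (Real.exp (-20) * ε ^ 2 * (M + 2) ^ 2 / n ^ 2) / 128 := by
        field_simp
        norm_num
      rw [h1, h2]
      linarith
    · intro x hx
      obtain ⟨hx1, hx2, hx3, hx4, -⟩ := hxb x hx
      have h1 := le_binExp hconv (m := M) hx3.le (by linarith) (Nat.zero_le M)
      have h2 := le_binomial_prob (M := M) (k := 0) (by omega) (by omega) hx3 (by linarith)
      have hMx : (M : ℝ) * x ≤ 1 := by nlinarith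
      have hMx0 : 0 < (M : ℝ) * x := by positivity
      have h3 : Real.exp (-20) ≤
          Real.exp (-((M * x - (0 : ℕ)) ^ 2 / (M * x * (1 - x)))) := by
        apply Real.exp_le_exp.mpr
        rw [neg_le_neg_iff, div_le_iff₀ (by nlinarith)]
        simp only [Nat.cast_zero, sub_zero]
        nlinarith
      have h4 : h (0 + 1 + 1) - h (0 + 1) - (h (0 + 1) - h 0) = l := by
        simp only [hh]
        push_cast
        rw [max_eq_right (by linarith), max_eq_right (by linarith), max_eq_left (by linarith)]
        ring
      rw [h4] at h1
      simp only [Nat.cast_zero, zero_add, Real.sqrt_one, mul_one] at h2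
      simp only [Nat.cast_zero] at h3
      have h5 : l * (Real.exp (-20) / 8) ≤ binExp M
          (fun j => h (j + 1 + 1) - h (j + 1) - (h (j + 1) - h j)) x := by
        refine le_trans ?_ h1
        gcongr
        linarith
      refine le_trans (le_of_eq ?_) (mul_le_mul hMM h5 (by positivity) (by positivity))
      ring
  · have hl1 : 1 ≤ l := by
      rw [hl, le_div_iff₀ hn', one_mul]; exact_mod_cast (not_le.mp hmn).le
    have hsl : 1 ≤ √l := Real.one_le_sqrt.mpr hl1
    have hsl2 : √l * √l = l := Real.mul_self_sqrt hl0.le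
    -- This is where `m ≤ n / ε ^ 2` enters: over the window the binomial mean moves by about `ε * l
    -- / 4 ≤ √l / 4`, so the kink stays within the scale `√l` of typical fluctuations.
    have hεl : ε * √l ≤ 1 := by
      have h1 : ε ^ 2 * l ≤ 1 := by
        rw [le_div_iff₀ (by positivity), hMc, ← hln] at hreg
        have : (ε ^ 2 * l) * n ≤ 1 * n := by linarith
        exact le_of_mul_le_mul_right this hn'
      refine (sq_le_one_iff₀ (by positivity)).mp ?_
      rwa [mul_pow, sq (√l), hsl2]
    refine ⟨(M + 2) ^ 2 * Real.exp (-20) / (128 * √l), by positivity, ?_, ?_⟩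
    · rw [gap, if_neg hmn, if_pos hreg, gapConst, ← hl, hMc]
      have hM2 : (M + 2 : ℝ) = √l * √l * n := by rw [hsl2, hln]
      rw [hM2]
      have : 0 < √l := by linarith
      apply le_of_eq
      field_simp
      norm_num
    · intro x hx
      obtain ⟨hx1, hx2, hx3, hx4, hx5⟩ := hxb x hx
      obtain ⟨k, hk1, hk2, hk3⟩ := exists_max_sub_nat_ge hl1
      have hl2 : l ≤ (M + 2) / 2 := by
        rw [le_div_iff₀ (by norm_num), ← hln]
        exact mul_le_mul_of_nonneg_left hn2 hl0.le
      have hkM : k < M := by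
        have h6 : (6 : ℝ) ≤ M := by exact_mod_cast hM6
        have : (k : ℝ) < M := by linarith
        exact_mod_cast this
      have h1 := le_binExp hconv (m := M) hx3.le (by linarith) hkM.le
      have hM' : (6 : ℝ) ≤ M := by exact_mod_cast hM6
      have hMx : (M : ℝ) * x = l * (n * x) - 2 * x := by
        rw [← mul_assoc, hln]; ring
      have hub : (M : ℝ) * x ≤ l := by
        have h7 := mul_le_mul_of_nonneg_left hx2 hl0.le
        linarith
      have hlb : l - √l / 4 - 1 ≤ M * x := by
        have h7 := mul_le_mul_of_nonneg_left hx5 hl0.le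
        have h8 : l * ε = (ε * √l) * √l := by rw [mul_assoc, hsl2, mul_comm]
        have h9 := mul_le_mul_of_nonneg_right hεl (Real.sqrt_nonneg l)
        linarith
      have hlb2 : l * (2 / 5) ≤ M * x := by
        have h7 : l * n * (3 / 4) ≤ M := by rw [hln]; linarith
        have h8 := mul_le_mul_of_nonneg_right h7 hx3.le
        have h9 := mul_le_mul_of_nonneg_left hx1 hl0.le
        linarith
      have h3 := le_binomial_prob_of_near hl1 (by omega) hkM hx3 hx4 (by linarith) (by linarith)
        (by linarith) hlb2
      have h5 : 1 / 2 * (Real.exp (-20) / (16 * √l)) ≤ binExp M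
          (fun j => h (j + 1 + 1) - h (j + 1) - (h (j + 1) - h j)) x := by
        refine le_trans ?_ h1
        exact mul_le_mul hk3 h3 (by positivity) (hconv k)
      refine le_trans (le_of_eq ?_) (mul_le_mul hMM h5 (by positivity) (by positivity))
      field_simp
      norm_num

end Gap

/-! ### Amplification by the median. -/

section Median

lemma card_gt_of_sorted {k : ℕ} (s : Fin k → ℝ) (q : Fin k) {v : ℝ}
    (h : v < s (Tuple.sort s q)) : k - q ≤ (Finset.univ.filter fun j => v < s j).card := by
  rw [← Fin.card_Ici, ← Finset.card_map (Tuple.sort s).toEmbedding]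
  refine Finset.card_le_card fun j hj => ?_
  obtain ⟨i, hi, rfl⟩ := Finset.mem_map.mp hj
  refine Finset.mem_filter.mpr ⟨Finset.mem_univ _, h.trans_le ?_⟩
  exact Tuple.monotone_sort s (Finset.mem_Ici.mp hi)

lemma card_lt_of_sorted {k : ℕ} (s : Fin k → ℝ) (q : Fin k) {u : ℝ}
    (h : s (Tuple.sort s q) < u) : q + 1 ≤ (Finset.univ.filter fun j => s j < u).card := by
  rw [← Fin.card_Iic, ← Finset.card_map (Tuple.sort s).toEmbedding]
  refine Finset.card_le_card fun j hj => ?_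
  obtain ⟨i, hi, rfl⟩ := Finset.mem_map.mp hj
  refine Finset.mem_filter.mpr ⟨Finset.mem_univ _, lt_of_le_of_lt ?_ h⟩
  exact Tuple.monotone_sort s (Finset.mem_Iic.mp hi)

/-- If more than half of the numbers lie in an interval, then so does the median. -/
lemma median_mem_Icc {k : ℕ} (s : Fin k → ℝ) {u v : ℝ}
    (h : 2 * (Finset.univ.filter fun j => s j ∉ Set.Icc u v).card < k) :
    median s ∈ Set.Icc u v := by
  have hk : 0 < k := by omega
  have key : ∀ q : Fin k, (k - 1) / 2 ≤ (q : ℕ) → (q : ℕ) ≤ k / 2 →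
      s (Tuple.sort s q) ∈ Set.Icc u v := by
    intro q h1 h2
    constructor
    · by_contra hlt
      have h3 := card_lt_of_sorted s q (not_le.mp hlt)
      have h4 := Finset.card_le_card (Finset.monotone_filter_right (Finset.univ : Finset (Fin k))
        (p := fun j => s j < u) (q := fun j => s j ∉ Set.Icc u v)
        fun j _ hj hj' => absurd hj'.1 (not_le.mpr hj))
      omega
    · by_contra hlt
      have h3 := card_gt_of_sorted s q (not_le.mp hlt)
      have h4 := Finset.card_le_card (Finset.monotone_filter_right (Finset.univ : Finset (Fin k))
        (p := fun j => v < s j) (q := fun j => s j ∉ Set.Icc u v)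
        fun j _ hj hj' => absurd hj'.2 (not_le.mpr hj))
      omega
  rw [median, dif_pos hk]
  have h1 := key ⟨(k - 1) / 2, by omega⟩ le_rfl (by simp only; omega)
  have h2 := key ⟨k / 2, by omega⟩ (by simp only; omega) le_rfl
  exact ⟨by linarith [h1.1, h2.1], by linarith [h1.2, h2.2]⟩

/-- If each of `k` independent trials fails with small probability, then it is exponentially
unlikely that half of them fail. -/
lemma majority_fail_le {β : Type*} [Fintype β] {w : β → ℝ} (hw : ∀ x, 0 ≤ w x)
    (hw1 : ∑ x, w x = 1) (P : β → Prop) [DecidablePred P]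
    (hP : wExp w (fun x => if P x then 1 else 0) ≤ 1 / 4096) (k : ℕ) :
    wExp (prodW w) (fun B : Fin k → β =>
      if k ≤ 2 * (Finset.univ.filter fun j => P (B j)).card then (1 : ℝ) else 0)
      ≤ (1 / 32) ^ k := by
  -- Chernoff bound with factor `64` per failure and `1 / 64` per success; one factor has mean at
  -- most `1 / 64 + 64 / 4096 = 1 / 32`.
  have h1 : ∀ B : Fin k → β,
      (if k ≤ 2 * (Finset.univ.filter fun j => P (B j)).card then (1 : ℝ) else 0)
        ≤ ∏ j, if P (B j) then (64 : ℝ) else 1 / 64 := by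
    intro B
    split_ifs with h
    · rw [Finset.prod_ite, Finset.prod_const, Finset.prod_const]
      have h2 := Finset.card_filter_add_card_filter_not (s := (Finset.univ : Finset (Fin k)))
        (fun j => P (B j))
      rw [Finset.card_univ, Fintype.card_fin] at h2
      set g := (Finset.univ.filter fun j => ¬ P (B j)).card
      set c := (Finset.univ.filter fun j => P (B j)).card
      have h3 : (64 : ℝ) ^ g ≤ 64 ^ c := pow_le_pow_right₀ (by norm_num) (by omega)
      rw [one_div, inv_pow, ← div_eq_mul_inv, le_div_iff₀ (by positivity), one_mul]
      exact h3
    · exact Finset.prod_nonneg fun j _ => by split_ifs <;> norm_num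
  refine (wExp_mono (prodW_nonneg hw) h1).trans ?_
  rw [wExp_prodW_prod k fun x => if P x then (64 : ℝ) else 1 / 64]
  refine pow_le_pow_left₀ (wExp_nonneg hw fun x => by split_ifs <;> norm_num) ?_ k
  have h2 : (fun x => if P x then (64 : ℝ) else 1 / 64)
      = fun x => 1 / 64 + (64 - 1 / 64) * (if P x then 1 else 0) := by
    funext x; split_ifs <;> norm_num
  rw [h2, wExp_add, wExp_const hw1, wExp_const_mul]
  linarith

end Median

/-! ### From measures to weighted sums; union bounds for the algorithm. -/

section Measure

variable {n : ℕ}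

lemma toReal_nonneg (p : PMF (Fin n)) (x : Fin n) : 0 ≤ (p x).toReal := ENNReal.toReal_nonneg

lemma sum_toReal (p : PMF (Fin n)) : ∑ x, (p x).toReal = 1 := by
  rw [← ENNReal.toReal_sum fun x _ => p.apply_ne_top x, ← tsum_fintype (L := .unconditional _),
    p.tsum_coe, ENNReal.toReal_one]

lemma samples_real_singleton (p : PMF (Fin n)) (N : ℕ) (T : Fin N → Fin n) :
    (samples p N).real {T} = prodW (fun x => (p x).toReal) T := by
  rw [samples, Measure.real, Measure.pi_singleton, ENNReal.toReal_prod]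
  exact Finset.prod_congr rfl fun t _ => by
    rw [PMF.toMeasure_apply_singleton _ _ (measurableSet_singleton _)]

lemma integral_samples (p : PMF (Fin n)) (N : ℕ) (F : (Fin N → Fin n) → ℝ) :
    ∫ T, F T ∂(samples p N) = wExp (prodW fun x => (p x).toReal) F := by
  rw [integral_fintype Integrable.of_finite]
  simp only [samples_real_singleton, wExp, smul_eq_mul]

lemma samples_real (p : PMF (Fin n)) (N : ℕ) (P : (Fin N → Fin n) → Prop) [DecidablePred P] :
    (samples p N).real {T | P T}
      = wExp (prodW fun x => (p x).toReal) (fun T => if P T then 1 else 0) := by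
  rw [← integral_samples, ← integral_indicator_one (MeasurableSet.of_discrete)]
  refine integral_congr_ae (Filter.Eventually.of_forall fun T => ?_)
  simp [Set.indicator_apply]

lemma meanUnif_eq [NeZero n] (m : ℕ) : meanUnif n m
    = wExp (prodW fun _ : Fin n => 1 / (n : ℝ)) (tvStat (n := n) (m := m)) := by
  rw [meanUnif, integral_samples]
  simp [unif]

lemma tvDist_unif [NeZero n] (p : PMF (Fin n)) :
    tvDist p (unif n) = (1 / 2) * ∑ x, |(p x).toReal - 1 / n| := by
  simp [tvDist, unif]

/-- Consecutive batches of independent samples are independent. -/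
lemma wExp_batches {α : Type*} [Fintype α] (w : α → ℝ) (k m : ℕ)
    (F : (Fin k → Fin m → α) → ℝ) :
    wExp (prodW w) (fun T : Fin (k * m) → α => F fun j i => T (finProdFinEquiv (j, i)))
      = wExp (prodW (prodW w)) F := by
  unfold wExp
  refine Fintype.sum_equiv
    ((Equiv.arrowCongr finProdFinEquiv.symm (Equiv.refl α)).trans (Equiv.curry _ _ _)) _ _ ?_
  intro T
  congr 1
  simp only [prodW]
  rw [← finProdFinEquiv.prod_comp, Fintype.prod_prod_type]
  rfl

/-- The median of the batch statistics is concentrated around their mean. -/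
lemma samples_median_le (p : PMF (Fin n)) {m : ℕ} (k : ℕ) {W : ℝ} (hW : 0 < W)
    (hvar : 4096 * wVar (prodW fun x => (p x).toReal) (tvStat (n := n) (m := m)) ≤ W ^ 2) :
    (samples p (k * m)).real
      {T | median (fun j : Fin k => tvStat fun i : Fin m => T (finProdFinEquiv (j, i))) ∈
        Set.Icc (wExp (prodW fun x => (p x).toReal) (tvStat (n := n) (m := m)) - W)
          (wExp (prodW fun x => (p x).toReal) (tvStat (n := n) (m := m)) + W)}ᶜ
      ≤ (1 / 32) ^ k := by
  classical
  set w : Fin n → ℝ := fun x => (p x).toReal with hw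
  set I := Set.Icc (wExp (prodW w) (tvStat (n := n) (m := m)) - W)
    (wExp (prodW w) (tvStat (n := n) (m := m)) + W) with hI
  have hw0 : ∀ T : Fin m → Fin n, 0 ≤ prodW w T := prodW_nonneg (toReal_nonneg p)
  have hw1 := sum_prodW (sum_toReal p) m
  have h1 := chebyshev (W := W) hw0 hw1 tvStat le_rfl (fun T => tvStat T ∉ I) (fun T hT => by
    by_contra hle
    rw [not_lt, abs_le] at hle
    exact hT ⟨by linarith [hle.1], by linarith [hle.2]⟩) hW.le
  have h2 : wExp (prodW w) (fun T : Fin m → Fin n => if tvStat T ∉ I then (1 : ℝ) else 0)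
      ≤ 1 / 4096 := by
    have hW2 : 0 < W ^ 2 := by positivity
    refine le_of_mul_le_mul_left ?_ hW2
    linarith
  refine le_trans ?_ (majority_fail_le hw0 hw1 (fun T => tvStat T ∉ I) h2 k)
  rw [← wExp_batches, ← samples_real]
  refine measureReal_mono fun T hT => ?_
  by_contra hlt
  exact hT (median_mem_Icc _ (not_le.mp hlt))

namespace RandAlg

/-- Union bound over bad seeds `Rᶜ` and bad samples `Gᶜ`; the version for two runs charges `Gᶜ`
twice. -/
lemma one_sub_le_outputProb (A : RandAlg n) (p : PMF (Fin n)) (b : Bool) (R : Set A.Seed)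
    (G : Set (Fin A.numSamples → Fin n)) (h : ∀ r ∈ R, ∀ T ∈ G, A.run T r = b) :
    1 - A.seedLaw.real Rᶜ - (samples p A.numSamples).real Gᶜ ≤ A.outputProb p b := by
  have hsub : (Set.univ : Set (A.Seed × (Fin A.numSamples → Fin n)))
      ⊆ ({ω | A.run ω.2 ω.1 = b} ∪ Rᶜ ×ˢ Set.univ) ∪ Set.univ ×ˢ Gᶜ := by
    rintro ⟨r, T⟩ -
    by_cases hr : r ∈ R
    · by_cases hT : T ∈ G
      · exact Or.inl (Or.inl (h r hr T hT))
      · exact Or.inr ⟨trivial, hT⟩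
    · exact Or.inl (Or.inr ⟨hr, trivial⟩)
  have h1 := measureReal_mono (μ := A.seedLaw.prod (samples p A.numSamples)) hsub
  have h2 := h1.trans (measureReal_union_le _ _)
  have h3 := h2.trans (add_le_add_left (measureReal_union_le _ _) _)
  simp only [measureReal_prod_prod, probReal_univ, mul_one, one_mul] at h3
  unfold outputProb
  linarith

lemma one_sub_le_agreeProb (A : RandAlg n) (p : PMF (Fin n)) (R : Set A.Seed)
    (G : Set (Fin A.numSamples → Fin n))
    (h : ∀ r ∈ R, ∀ T ∈ G, ∀ T' ∈ G, A.run T r = A.run T' r) :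
    1 - A.seedLaw.real Rᶜ - 2 * (samples p A.numSamples).real Gᶜ ≤ A.agreeProb p := by
  have hsub : (Set.univ : Set (A.Seed × (Fin A.numSamples → Fin n) × (Fin A.numSamples → Fin n)))
      ⊆ (({ω | A.run ω.2.1 ω.1 = A.run ω.2.2 ω.1} ∪ Rᶜ ×ˢ Set.univ ×ˢ Set.univ)
        ∪ Set.univ ×ˢ Gᶜ ×ˢ Set.univ) ∪ Set.univ ×ˢ Set.univ ×ˢ Gᶜ := by
    rintro ⟨r, T, T'⟩ -
    by_cases hr : r ∈ R
    · by_cases hT : T ∈ G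
      · by_cases hT' : T' ∈ G
        · exact Or.inl (Or.inl (Or.inl (h r hr T hT T' hT')))
        · exact Or.inr ⟨trivial, trivial, hT'⟩
      · exact Or.inl (Or.inr ⟨trivial, hT, trivial⟩)
    · exact Or.inl (Or.inl (Or.inr ⟨hr, trivial, trivial⟩))
  have h1 := measureReal_mono
    (μ := A.seedLaw.prod ((samples p A.numSamples).prod (samples p A.numSamples))) hsub
  have h2 := h1.trans (measureReal_union_le _ _)
  have h3 := h2.trans (add_le_add_left (measureReal_union_le _ _) _)
  have h4 := h3.trans (add_le_add_left (add_le_add_left (measureReal_union_le _ _) _) _)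
  simp only [measureReal_prod_prod, probReal_univ, mul_one, one_mul] at h4
  unfold agreeProb
  linarith

end RandAlg

/-- The probability that a uniform random element of `[a, b]` falls into a short interval. -/
lemma cond_Icc_real_le {a b u v : ℝ} (hab : a < b) (huv : u ≤ v) {B : Set ℝ}
    (hB : B ∩ Set.Icc a b ⊆ Set.Icc u v) :
    (ProbabilityTheory.cond volume (Set.Icc a b)).real B ≤ (v - u) / (b - a) := by
  rw [Measure.real, ProbabilityTheory.cond_apply measurableSet_Icc, Set.inter_comm,
    ENNReal.toReal_mul, ENNReal.toReal_inv, ← Measure.real, ← Measure.real,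
    Real.volume_real_Icc_of_le hab.le, inv_mul_eq_div]
  have h : volume.real (B ∩ Set.Icc a b) ≤ v - u := by
    rw [← Real.volume_real_Icc_of_le huv]
    exact measureReal_mono hB (by simp)
  have : 0 < b - a := by linarith
  gcongr

end Measure

/-! ### Fluctuations against the gap. -/

section Parameters

variable {n : ℕ} [NeZero n]

lemma gap_pos {m : ℕ} (hm : 0 < m) {ε : ℝ} (hε : 0 < ε) : 0 < gap n m ε := by
  have hn' : (0 : ℝ) < n := by exact_mod_cast Nat.pos_of_neZero n
  have hm' : (0 : ℝ) < m := by exact_mod_cast hm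
  unfold gap
  split_ifs <;> positivity

/-- With enough samples, either the fluctuations of the statistic are a `ρ`-fraction of the gap,
or its mean is far above that for the uniform distribution. -/
theorem exists_window {w : Fin n → ℝ} (hw : ∀ x, 0 ≤ w x) (hw1 : ∑ x, w x = 1)
    {ε ρ C κ : ℝ} (hε : 0 < ε) (hε1 : ε < 1 / 2) (hρ : 0 < ρ) (hρ1 : ρ < 1 / 2)
    (hC1 : C ≤ 1 / 2) (hκ : 0 < κ) (hκ1 : κ ≤ 1) {m : ℕ}
    (h1 : 1000 / κ * √n ≤ m * (ρ * ε ^ 2)) (h2 : (1000 / κ) ^ 2 ≤ m * (ρ ^ 2 * ε ^ 2)) :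
    ∃ W, 0 < W ∧ 4096 * wVar (prodW w) (tvStat (n := n) (m := m)) ≤ W ^ 2 ∧
      (W ≤ ρ * κ * gap n m ε / 8 ∨
        wExp (prodW fun _ : Fin n => 1 / (n : ℝ)) (tvStat (n := n) (m := m)) + C * gap n m ε
          ≤ wExp (prodW w) (tvStat (n := n) (m := m)) - W) := by
  have hn' : (0 : ℝ) < n := by exact_mod_cast Nat.pos_of_neZero n
  have hm : 0 < m := by
    rcases Nat.eq_zero_or_pos m with rfl | h
    · exfalso
      have : 0 < (1000 / κ) ^ 2 := by positivity
      simp at h2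
      linarith
    · exact h
  have hm' : (0 : ℝ) < m := by exact_mod_cast hm
  have hg : 0 < gap n m ε := gap_pos hm hε
  have h3 : 1000000 * n ≤ (m : ℝ) ^ 2 * ρ ^ 2 * ε ^ 4 * κ ^ 2 := by
    have h4 : 1000 * √n ≤ m * (ρ * ε ^ 2) * κ := by
      have := mul_le_mul_of_nonneg_right h1 hκ.le
      refine le_trans (le_of_eq ?_) this
      field_simp
    have h5 := pow_le_pow_left₀ (by positivity) h4 2
    rw [mul_pow, Real.sq_sqrt hn'.le] at h5
    linarith
  have h4 : 1000000 ≤ (m : ℝ) * ρ ^ 2 * ε ^ 2 * κ ^ 2 := by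
    have := mul_le_mul_of_nonneg_right h2 (sq_nonneg κ)
    rw [div_pow, div_mul_cancel₀ _ (by positivity)] at this
    linarith
  by_cases hmn : m ≤ n
  · have hg' : gap n m ε = ε ^ 2 * m ^ 2 / n ^ 2 := by rw [gap, if_pos hmn]
    have hvar := wVar_tvStat_le_of_le hw hw1 hm hmn
    set V := wVar (prodW w) (tvStat (n := n) (m := m))
    set ν := wExp (prodW w) (tvStat (n := n) (m := m))
    set μ := wExp (prodW fun _ : Fin n => 1 / (n : ℝ)) (tvStat (n := n) (m := m))
    -- With a small mean excess, the variance is of the order of the bound for uniform samples.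
    -- Otherwise `n ^ 2 * V ≤ 3 * (n * (ν - μ))` with `n * (ν - μ) ≥ 10 ^ 6`, so half the excess is
    -- a valid window and the other half covers `C * gap`.
    rcases le_total ((n : ℝ) * (ν - μ)) ((m : ℝ) ^ 2 / n) with hΔ | hΔ
    · refine ⟨ρ * κ * gap n m ε / 8, by positivity, ?_, Or.inl le_rfl⟩
      have h5 : (n : ℝ) ^ 2 * V ≤ 3 * ((m : ℝ) ^ 2 / n) := by linarith
      have h6 : 0 < (n : ℝ) ^ 2 := by positivity
      refine le_of_mul_le_mul_left ?_ h6
      have h7 : (n : ℝ) ^ 2 * (ρ * κ * gap n m ε / 8) ^ 2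
          = ((m : ℝ) ^ 2 * ρ ^ 2 * ε ^ 4 * κ ^ 2) * (m ^ 2 / n ^ 2) / 64 := by
        rw [hg']; field_simp; norm_num
      have h8 := mul_le_mul_of_nonneg_right h3 (by positivity : 0 ≤ (m : ℝ) ^ 2 / n ^ 2)
      have h9 : 1000000 * (n : ℝ) * (m ^ 2 / n ^ 2) = 1000000 * ((m : ℝ) ^ 2 / n) := by field_simp
      have h10 : 0 ≤ (m : ℝ) ^ 2 / n := by positivity
      rw [h7]
      linarith
    · have h5 : 1000000 ≤ (m : ℝ) ^ 2 / n := by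
        rw [le_div_iff₀ hn']
        refine h3.trans ?_
        have h6 : ρ ^ 2 * ε ^ 4 * κ ^ 2 ≤ 1 := by
          have ha : ρ ^ 2 ≤ 1 := pow_le_one₀ hρ.le (by linarith)
          have hb : ε ^ 4 ≤ 1 := pow_le_one₀ hε.le (by linarith)
          have hc : κ ^ 2 ≤ 1 := pow_le_one₀ hκ.le hκ1
          exact mul_le_one₀ (mul_le_one₀ ha (by positivity) hb) (by positivity) hc
        have h7 := mul_le_mul_of_nonneg_left h6 (by positivity : 0 ≤ (m : ℝ) ^ 2)
        linarith
      have h6 : 0 < ν - μ := by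
        have : 0 < (n : ℝ) * (ν - μ) := by linarith
        exact (mul_pos_iff_of_pos_left hn').mp this
      refine ⟨(ν - μ) / 2, by positivity, ?_, Or.inr ?_⟩
      · have h7 : 0 < (n : ℝ) ^ 2 := by positivity
        refine le_of_mul_le_mul_left ?_ h7
        have h8 : (n : ℝ) ^ 2 * ((ν - μ) / 2) ^ 2 = ((n : ℝ) * (ν - μ)) * (n * (ν - μ)) / 4 := by
          ring
        have h9 : 1000000 * (n * (ν - μ)) ≤ ((n : ℝ) * (ν - μ)) * (n * (ν - μ)) :=
          mul_le_mul_of_nonneg_right (by linarith) (by positivity)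
        rw [h8]
        linarith
      · have h7 : C * gap n m ε ≤ (ν - μ) / 2 := by
          have h8 : (m : ℝ) ^ 2 / n ^ 2 ≤ ν - μ := by
            rw [div_le_iff₀ (by positivity)]
            rw [div_le_iff₀ hn'] at hΔ
            linarith
          have h9 : gap n m ε ≤ (m : ℝ) ^ 2 / n ^ 2 := by
            rw [hg', mul_div_assoc]
            exact mul_le_of_le_one_left (by positivity) (pow_le_one₀ hε.le (by linarith))
          have h10 := mul_le_mul hC1 (h9.trans h8) hg.le (by norm_num)
          linarith
        linarith
  · refine ⟨ρ * κ * gap n m ε / 8, by positivity, ?_, Or.inl le_rfl⟩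
    have h5 := wVar_tvStat_le hw hw1 hm
    -- The constant is `4096 * 8 ^ 2`. The `√n` term of the batch size settles the middle regime,
    -- the `1 / (ρ ^ 2 * ε ^ 2)` term the last.
    suffices h6 : 262144 / (m : ℝ) ≤ (ρ * κ * gap n m ε) ^ 2 by
      have h7 : 262144 / (m : ℝ) = 262144 * (1 / m) := by ring
      rw [div_pow]
      linarith
    rw [div_le_iff₀ hm']
    by_cases hreg : (m : ℝ) ≤ n / ε ^ 2
    · rw [gap, if_neg hmn, if_pos hreg]
      have h6 : (ρ * κ * (ε ^ 2 * √((m : ℝ) / n))) ^ 2 * m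
          = (m : ℝ) ^ 2 * ρ ^ 2 * ε ^ 4 * κ ^ 2 / n := by
        rw [mul_pow, mul_pow, mul_pow, Real.sq_sqrt (by positivity)]
        ring
      rw [h6, le_div_iff₀ hn']
      linarith
    · rw [gap, if_neg hmn, if_neg hreg]
      linarith [h4, (by ring : (ρ * κ * ε) ^ 2 * m = (m : ℝ) * ρ ^ 2 * ε ^ 2 * κ ^ 2)]

end Parameters

/-! ### Correctness, replicability and sample count. -/

section Tester

variable {n : ℕ} [NeZero n]

/-- The tester is correct and replicable once it has enough batches of enough samples. -/
theorem medianTester_solves {ε ρ C a b : ℝ} (ha : 0 ≤ a) (hab : a < b) (hb : b ≤ 1)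
    (hε : 0 < ε) (hε1 : ε < 1 / 2) (hρ : 0 < ρ) (hρ1 : ρ < 1 / 2)
    (hC : 0 < C) (hC1 : 2 * C ≤ gapConst) {k m : ℕ} (hm : 8 ≤ m)
    (h1 : 1000 / ((b - a) * C) * √n ≤ m * (ρ * ε ^ 2))
    (h2 : (1000 / ((b - a) * C)) ^ 2 ≤ m * (ρ ^ 2 * ε ^ 2))
    (hk : (1 / 32 : ℝ) ^ k ≤ ρ / 4) :
    (medianTester n ε C a b hab k m).Solves ε ρ := by
  have hba : 0 < b - a := by linarith
  have hCh : C ≤ 1 / 2 := by linarith [gapConst_le]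
  have hκ : 0 < (b - a) * C := by positivity
  have hκC : (b - a) * C ≤ C := mul_le_of_le_one_left hC.le (by linarith)
  have hg : 0 < gap n m ε := gap_pos (by omega) hε
  have hCg : 0 < C * gap n m ε := by positivity
  have hwin := fun p : PMF (Fin n) => exists_window (w := fun x => (p x).toReal)
    (toReal_nonneg p) (sum_toReal p) hε hε1 hρ hρ1 hCh hκ (by linarith) h1 h2
  have hbC : ∀ r ≤ b, r * (C * gap n m ε) ≤ C * gap n m ε := fun r hr =>
    mul_le_of_le_one_left hCg.le (hr.trans hb)
  set G : PMF (Fin n) → ℝ → Set (Fin (k * m) → Fin n) := fun p W =>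
    {T | median (fun j : Fin k => tvStat fun i : Fin m => T (finProdFinEquiv (j, i))) ∈
      Set.Icc (wExp (prodW fun x => (p x).toReal) (tvStat (n := n) (m := m)) - W)
        (wExp (prodW fun x => (p x).toReal) (tvStat (n := n) (m := m)) + W)} with hG
  have hGp : ∀ p W, 0 < W →
      4096 * wVar (prodW fun x => (p x).toReal) (tvStat (n := n) (m := m)) ≤ W ^ 2 →
      (samples p (k * m)).real (G p W)ᶜ ≤ ρ / 4 := fun p W hW hv =>
    (samples_median_le p k hW hv).trans hk
  set seed : Measure ℝ := ProbabilityTheory.cond volume (Set.Icc a b) with hseed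
  have hIcc : seed.real (Set.Icc a b)ᶜ ≤ 0 := by
    have := cond_Icc_real_le (u := 0) (v := 0) (B := (Set.Icc a b)ᶜ) hab le_rfl (by simp)
    simpa using this
  have hrun : ∀ (T : Fin (k * m) → Fin n) (r : ℝ),
      (medianTester n ε C a b hab k m).run T r = decide
        (median (fun j : Fin k => tvStat fun i : Fin m => T (finProdFinEquiv (j, i)))
          < meanUnif n m + r * (C * gap n m ε)) := fun _ _ => rfl
  have hout : ∀ (p : PMF (Fin n)) (o : Bool) (R : Set ℝ) (G' : Set (Fin (k * m) → Fin n)),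
      (∀ r ∈ R, ∀ T ∈ G', (medianTester n ε C a b hab k m).run T r = o) →
      1 - seed.real Rᶜ - (samples p (k * m)).real G'ᶜ
        ≤ (medianTester n ε C a b hab k m).outputProb p o :=
    RandAlg.one_sub_le_outputProb (medianTester n ε C a b hab k m)
  have hagree : ∀ (p : PMF (Fin n)) (R : Set ℝ) (G' : Set (Fin (k * m) → Fin n)),
      (∀ r ∈ R, ∀ T ∈ G', ∀ T' ∈ G', (medianTester n ε C a b hab k m).run T r
        = (medianTester n ε C a b hab k m).run T' r) →
      1 - seed.real Rᶜ - 2 * (samples p (k * m)).real G'ᶜ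
        ≤ (medianTester n ε C a b hab k m).agreeProb p :=
    RandAlg.one_sub_le_agreeProb (medianTester n ε C a b hab k m)
  have hμ := meanUnif_eq (n := n) m
  have hhigh : ∀ p W, meanUnif n m + C * gap n m ε
      ≤ wExp (prodW fun x => (p x).toReal) (tvStat (n := n) (m := m)) - W →
      ∀ r ∈ Set.Icc a b, ∀ T ∈ G p W, (medianTester n ε C a b hab k m).run T r = false := by
    intro p W h r hr T hT
    rw [hrun, decide_eq_false_iff_not, not_lt]
    have := hbC r hr.2
    linarith [hT.1]
  have hlen : ∀ W, W ≤ ρ * ((b - a) * C) * gap n m ε / 8 →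
      W / (C * gap n m ε) / (b - a) ≤ ρ / 8 := by
    intro W hW
    rw [div_div, div_le_iff₀ (by positivity)]
    linarith
  refine ⟨?_, ?_, ?_⟩
  · intro p
    obtain ⟨W, hW, hv, hlow | hhi⟩ := hwin p
    · set ν := wExp (prodW fun x => (p x).toReal) (tvStat (n := n) (m := m)) with hν
      -- When both medians lie in the window, the runs can differ only if the threshold does too.
      -- Bad seeds cost `ρ / 4` and each bad sample `ρ / 4`.
      have hR : seed.real {r | r * (C * gap n m ε) ∉
          Set.Icc (ν - W - meanUnif n m) (ν + W - meanUnif n m)}ᶜ ≤ ρ / 4 := by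
        refine (cond_Icc_real_le (u := (ν - W - meanUnif n m) / (C * gap n m ε))
          (v := (ν + W - meanUnif n m) / (C * gap n m ε)) hab (by gcongr; linarith) ?_).trans ?_
        · rintro r ⟨hr, -⟩
          have hr' := not_not.mp hr
          exact ⟨(div_le_iff₀ hCg).mpr hr'.1, (le_div_iff₀ hCg).mpr hr'.2⟩
        · have h3 := hlen W hlow
          have h4 : ((ν + W - meanUnif n m) / (C * gap n m ε)
              - (ν - W - meanUnif n m) / (C * gap n m ε)) / (b - a)
              = 2 * (W / (C * gap n m ε) / (b - a)) := by ring
          rw [h4]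
          linarith
      have h3 := hagree p
        {r | r * (C * gap n m ε) ∉ Set.Icc (ν - W - meanUnif n m) (ν + W - meanUnif n m)}
        (G p W) (by
          intro r hr T hT T' hT'
          rw [hrun, hrun]
          congr 1
          rw [eq_iff_iff]
          by_cases hlo : ν - W - meanUnif n m ≤ r * (C * gap n m ε)
          · have hup : ν + W - meanUnif n m < r * (C * gap n m ε) := by
              by_contra hcon
              exact hr ⟨hlo, not_lt.mp hcon⟩
            exact iff_of_true (by linarith [hT.2]) (by linarith [hT'.2])
          · rw [not_le] at hlo
            exact iff_of_false (by linarith [hT.1]) (by linarith [hT'.1]))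
      have h4 := hGp p W hW hv
      linarith
    · rw [← hμ] at hhi
      have h3 := hagree p
        (Set.Icc a b) (G p W) (by
          intro r hr T hT T' hT'
          rw [hhigh p W hhi r hr T hT, hhigh p W hhi r hr T' hT'])
      have h4 := hGp p W hW hv
      linarith
  · obtain ⟨W, hW, hv, hwd⟩ := hwin (unif n)
    have hν : wExp (prodW fun x => (unif n x).toReal) (tvStat (n := n) (m := m))
        = meanUnif n m := by
      rw [hμ]; simp [unif]
    -- The uniform mean cannot exceed itself by a positive amount, which excludes the second
    -- alternative.
    have hlow : W ≤ ρ * ((b - a) * C) * gap n m ε / 8 := by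
      rcases hwd with h | h
      · exact h
      · rw [hν, ← hμ] at h
        linarith
    -- Since `a = 0` is allowed, thresholds within `W` of the uniform mean must be discarded as bad
    -- seeds.
    have hR : seed.real {r | W < r * (C * gap n m ε)}ᶜ ≤ ρ / 8 := by
      refine (cond_Icc_real_le (u := 0) (v := W / (C * gap n m ε)) hab (by positivity) ?_).trans ?_
      · rintro r ⟨hr, hr'⟩
        exact ⟨ha.trans hr'.1, (le_div_iff₀ hCg).mpr (not_lt.mp hr)⟩
      · rw [sub_zero]
        exact hlen W hlow
    have h3 := hout (unif n) true
      {r | W < r * (C * gap n m ε)} (G (unif n) W) (by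
        intro r hr T hT
        rw [hrun, decide_eq_true_eq]
        have h5 := hT.2
        rw [hν] at h5
        have h6 : W < r * (C * gap n m ε) := hr
        exact h5.trans_lt (by linarith))
    have h4 := hGp (unif n) W hW hv
    linarith
  · intro p hp
    rw [tvDist_unif] at hp
    obtain ⟨W, hW, hv, hwd⟩ := hwin p
    have hfar := expectation_gap (toReal_nonneg p) (sum_toReal p) hε hε1 hp hm
    rw [← hμ] at hfar hwd
    have hhi : meanUnif n m + C * gap n m ε
        ≤ wExp (prodW fun x => (p x).toReal) (tvStat (n := n) (m := m)) - W := by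
      -- The far mean is at least `2 * C * gap` above the uniform one: one `C * gap` covers the
      -- largest threshold, the other covers `W`.
      rcases hwd with h | h
      · have h5 := mul_le_mul_of_nonneg_right hC1 hg.le
        have h6 : ρ * ((b - a) * C) * gap n m ε ≤ 1 * C * gap n m ε := by
          gcongr
          linarith
        linarith
      · exact h
    have h3 := hout p false
      (Set.Icc a b) (G p W) (hhigh p W hhi)
    have h4 := hGp p W hW hv
    linarith

lemma le_log_div {ρ : ℝ} (hρ : 0 < ρ) (hρ1 : ρ < 1 / 2) : 1 / 4 ≤ Real.log (n / ρ) ∧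
    Real.log (1 / ρ) ≤ Real.log (n / ρ) := by
  have hn : (1 : ℝ) ≤ n := by exact_mod_cast Nat.pos_of_neZero n
  have h1 : Real.log (1 / ρ) ≤ Real.log (n / ρ) :=
    Real.log_le_log (by positivity) (by gcongr)
  have h2 : Real.log 2 ≤ Real.log (1 / ρ) :=
    Real.log_le_log (by norm_num) (by rw [le_div_iff₀ hρ]; linarith)
  exact ⟨by linarith [Real.log_two_gt_d9], h1⟩

/-- As `1 / 32 ≤ exp (-3)`, at least `log (1 / ρ)` batches give `ρ ^ 3 ≤ ρ / 4`. -/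
lemma pow_numBatches_le {ρ : ℝ} (hρ : 0 < ρ) (hρ1 : ρ < 1 / 2) :
    (1 / 32 : ℝ) ^ numBatches 1 ρ ≤ ρ / 4 := by
  have h1 : Real.log (1 / ρ) ≤ numBatches 1 ρ := by
    rw [numBatches, one_mul]; exact Nat.le_ceil _
  have h2 : (1 / 32 : ℝ) ≤ Real.exp (-3) := by
    have h3 : Real.exp 3 ≤ 32 := by
      have h4 : Real.exp 3 = Real.exp 1 ^ 3 := by rw [← Real.exp_nat_mul]; norm_num
      rw [h4]
      calc Real.exp 1 ^ 3 ≤ 3 ^ 3 :=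
            pow_le_pow_left₀ (Real.exp_pos _).le (by linarith [Real.exp_one_lt_d9]) 3
        _ ≤ 32 := by norm_num
    rw [Real.exp_neg, ← one_div]
    exact one_div_le_one_div_of_le (Real.exp_pos _) h3
  have h3 : Real.exp (-3) ^ numBatches 1 ρ ≤ ρ ^ 3 := by
    have h4 : ρ ^ 3 = Real.exp (3 * Real.log ρ) := by
      rw [show (3 : ℝ) = (3 : ℕ) by norm_num, Real.exp_nat_mul, Real.exp_log hρ]
    rw [← Real.exp_nat_mul, h4]
    apply Real.exp_le_exp.mpr
    rw [one_div, Real.log_inv] at h1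
    linarith
  refine (pow_le_pow_left₀ (by norm_num) h2 _).trans (h3.trans ?_)
  nlinarith [mul_pos hρ hρ]

/-- The logarithm in the batch size is used only through `√(log (n / ρ)) ≥ 1 / 2`; the factor `2` in
`hc` compensates. -/
lemma batchSize_bounds {c B ε ρ : ℝ} (hB : 8 ≤ B) (hc : 2 * B ^ 2 ≤ c) (hε : 0 < ε)
    (hε1 : ε < 1 / 2) (hρ : 0 < ρ) (hρ1 : ρ < 1 / 2) :
    8 ≤ batchSize c n ε ρ ∧ B * √n ≤ batchSize c n ε ρ * (ρ * ε ^ 2) ∧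
      B ^ 2 ≤ batchSize c n ε ρ * (ρ ^ 2 * ε ^ 2) := by
  have hn : (1 : ℝ) ≤ n := by exact_mod_cast Nat.pos_of_neZero n
  have hc0 : 0 < c := by nlinarith
  have hcB : 2 * B ≤ c := by nlinarith
  have hL : 1 / 2 ≤ √(Real.log (n / ρ)) :=
    Real.le_sqrt_of_sq_le (by linarith [(le_log_div (n := n) hρ hρ1).1])
  have h1 : c * (√n / (ρ * ε ^ 2) * √(Real.log (n / ρ)) + 1 / (ρ ^ 2 * ε ^ 2))
      ≤ batchSize c n ε ρ := Nat.le_ceil _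
  have h2 : 0 ≤ c * (√n / (ρ * ε ^ 2) * √(Real.log (n / ρ))) := by positivity
  have h3 : 0 ≤ c * (1 / (ρ ^ 2 * ε ^ 2)) := by positivity
  have h4 : B ^ 2 ≤ batchSize c n ε ρ * (ρ ^ 2 * ε ^ 2) := by
    have h5 : c * (1 / (ρ ^ 2 * ε ^ 2)) ≤ batchSize c n ε ρ := by linarith
    rw [mul_one_div, div_le_iff₀ (by positivity)] at h5
    nlinarith
  refine ⟨?_, ?_, h4⟩
  · have h5 : ρ ^ 2 * ε ^ 2 ≤ 1 := mul_le_one₀ (pow_le_one₀ hρ.le (by linarith)) (by positivity)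
      (pow_le_one₀ hε.le (by linarith))
    have h6 : (batchSize c n ε ρ : ℝ) * (ρ ^ 2 * ε ^ 2) ≤ batchSize c n ε ρ :=
      mul_le_of_le_one_right (Nat.cast_nonneg _) h5
    have h7 : (8 : ℝ) ≤ batchSize c n ε ρ := by nlinarith
    exact_mod_cast h7
  · have h5 : c * (√n / (ρ * ε ^ 2) * (1 / 2)) ≤ batchSize c n ε ρ := by
      refine le_trans ?_ ((by linarith : c * (√n / (ρ * ε ^ 2) * √(Real.log (n / ρ))) ≤ _))
      gcongr
    have h6 : c * (√n / (ρ * ε ^ 2) * (1 / 2)) = c / 2 * √n / (ρ * ε ^ 2) := by ring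
    rw [h6, div_le_iff₀ (by positivity)] at h5
    refine le_trans ?_ h5
    gcongr
    linarith

/-- One logarithm comes from the number of batches, one from `√L ≤ 2 * L`; the roundings are
absorbed because `L ≥ 1 / 4` and `c * Q ≥ 1`. -/
lemma numSamples_le {c ε ρ : ℝ} (hc : 1 ≤ c) (hε : 0 < ε) (hε1 : ε < 1 / 2) (hρ : 0 < ρ)
    (hρ1 : ρ < 1 / 2) :
    ((numBatches 1 ρ * batchSize c n ε ρ : ℕ) : ℝ) ≤
      40 * c * Real.log (n / ρ) ^ 2 * (√n / (ε ^ 2 * ρ) + 1 / (ρ ^ 2 * ε ^ 2)) := by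
  have hn : (1 : ℝ) ≤ n := by exact_mod_cast Nat.pos_of_neZero n
  obtain ⟨hL, hL'⟩ := le_log_div (n := n) hρ hρ1
  set L := Real.log (n / ρ) with hLdef
  have hlog : 0 ≤ Real.log (1 / ρ) := Real.log_nonneg (by rw [le_div_iff₀ hρ]; linarith)
  have h1 : (numBatches 1 ρ : ℝ) ≤ 5 * L := by
    have := Nat.ceil_lt_add_one (a := 1 * Real.log (1 / ρ)) (by linarith)
    rw [numBatches]
    linarith
  have hsL : √L ≤ 2 * L := by
    refine Real.sqrt_le_iff.mpr ⟨by linarith, ?_⟩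
    nlinarith
  have hP : 0 ≤ √n / (ρ * ε ^ 2) := by positivity
  have hQ : 1 ≤ 1 / (ρ ^ 2 * ε ^ 2) := by
    rw [le_div_iff₀ (by positivity), one_mul]
    exact mul_le_one₀ (pow_le_one₀ hρ.le (by linarith)) (by positivity)
      (pow_le_one₀ hε.le (by linarith))
  set P := √n / (ρ * ε ^ 2) with hPdef
  set Q := 1 / (ρ ^ 2 * ε ^ 2) with hQdef
  have h2 : (batchSize c n ε ρ : ℝ) ≤ 5 * L * c * (P + Q) + 3 * L * c * Q := by
    have h3 := Nat.ceil_lt_add_one (a := c * (P * √L + Q)) (by positivity)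
    rw [batchSize]
    have h4 : P * √L ≤ P * (2 * L) := by gcongr
    have h5 : c * (P * √L) ≤ c * (P * (2 * L)) := by gcongr
    have h6 : c * Q * 1 ≤ c * Q * (4 * L) := by gcongr; linarith
    have h7 : 1 ≤ c * Q := by nlinarith
    have h8 : 0 ≤ c * P * L := by positivity
    linarith
  have h3 : √n / (ε ^ 2 * ρ) = P := by rw [hPdef, mul_comm ρ]
  rw [h3]
  push_cast
  have h4 : (batchSize c n ε ρ : ℝ) ≤ 8 * L * c * (P + Q) := by
    have : 0 ≤ L * c * P := by positivity
    linarith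
  calc (numBatches 1 ρ : ℝ) * batchSize c n ε ρ ≤ (5 * L) * (8 * L * c * (P + Q)) := by gcongr
    _ = 40 * c * L ^ 2 * (P + Q) := by ring

end Tester

end ReplicableUniformity

end


theorem theorem1 (a b : ℝ) (ha : 0 ≤ a) (hab : a < b) (hb : b ≤ 1) :
    ∃ C c₀ c₁ : ℝ, 0 < C ∧ 0 < c₀ ∧ 0 < c₁ ∧ ∃ (K : ℝ) (k : ℕ),
      ∀ (n : ℕ) [NeZero n] (ε ρ : ℝ), 0 < ε → ε < 1 / 2 → 0 < ρ → ρ < 1 / 2 →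
        (ReplicableUniformity.rUniformityTester C c₀ c₁ a b hab n ε ρ).Solves ε ρ ∧
        ((ReplicableUniformity.rUniformityTester C c₀ c₁ a b hab n ε ρ).numSamples : ℝ) ≤
          K * Real.log (n / ρ) ^ k * (√n / (ε ^ 2 * ρ) + 1 / (ρ ^ 2 * ε ^ 2)) := by
  have hC : 0 < ReplicableUniformity.gapConst / 2 :=
    half_pos ReplicableUniformity.gapConst_pos
  have hC1 := ReplicableUniformity.gapConst_le
  -- Half the gap constant, so that far means clear even the largest threshold by `C * gap`.
  set C := ReplicableUniformity.gapConst / 2 with hCdef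
  have hba : 0 < b - a := by linarith
  have hκ : 0 < (b - a) * C := by positivity
  have hκ1 : (b - a) * C ≤ 1 := mul_le_one₀ (by linarith) hC.le (by linarith)
  set B := 1000 / ((b - a) * C) with hB
  have hB8 : 8 ≤ B := by
    rw [hB, le_div_iff₀ hκ]
    linarith
  refine ⟨C, 1, 2 * B ^ 2, hC, one_pos, by positivity, 40 * (2 * B ^ 2), 2, ?_⟩
  intro n _ ε ρ hε hε1 hρ hρ1
  obtain ⟨hm, h1, h2⟩ := ReplicableUniformity.batchSize_bounds (n := n) hB8 le_rfl hε hε1 hρ hρ1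
  exact ⟨ReplicableUniformity.medianTester_solves ha hab hb hε hε1 hρ hρ1 hC (by linarith) hm h1 h2
    (ReplicableUniformity.pow_numBatches_le hρ hρ1),
    ReplicableUniformity.numSamples_le (by nlinarith) hε hε1 hρ hρ1⟩
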